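/- For exponents $\gamma,\delta$ let $v^{\gamma,\delta}(x)=(1-x)^\gamma(1+x)^\delta$, $x\in(-1,1)$. Spaces. For $v=v^{\gamma,\delta}$ with $\gamma,\delta\ge 0$, let $C^0_v$ be the space of all real functions $f$ continuous on $(-1,1)$ for which $fv$ extends continuously to $[-1,1]$, with value $0$ at $1$ if $\gamma>0$ and value $0$ at $-1$ if $\delta>0$; its norm is $\|fv\|_\infty=\sup_{|x|<1}|f(x)|v(x)$. Let $E_k(f)_v=\inf_{\deg P\le k}\|(f-P)v\|_\infty$ be the error of best approximation by polynomials of degree at most $k$. For $r>0$ let $B_r(v)$ be the set of all $f\in C^0_v$ with $$\|f\|_{B_r(v)}:=\|fv\|_\infty+\sum_{k=1}^\infty (k+1)^{r-1}E_k(f)_v<\infty .$$ Filtered polynomial. Let $w=v^{\alpha,\beta}$ with $\alpha,\beta>-1$, let $p_j(w,\cdot)$ be the orthonormal polynomial of degree $j$ with positive leading coefficient with respect to $w$ on $(-1,1)$, let $x_1,\dots,x_n$ be the zeros of $p_n(w,\cdot)$, and let $\lambda_k=\bigl(\sum_{j=0}^{n-1}p_j(w,x_k)^2\bigr)^{-1}$.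 For integers $0<m<n$ put $$V_n^m(w,f,x)=\sum_{k=1}^n f(x_k)\,\lambda_k\sum_{j=0}^{n+m-1}\mu_{n,j}^m\,p_j(w,x_k)\,p_j(w,x),$$ where $\mu_{n,j}^m=1$ for $0\le j\le n-m$ and $\mu_{n,j}^m=\frac{n+m-j}{2m}$ for $n-m<j<n+m$. Quadrature rule. Let $u=v^{a,b}$ with $a,b>-1$. For $t\in(-1,1)$ let $$\mathcal H^uf(t)=\lim_{\epsilon\to0^+}\int_{x\in(-1,1),\,|x-t|\ge\epsilon}\frac{f(x)}{x-t}\,u(x)\,dx,$$ let $\mathcal H^u_{n,m}(w,f,t)=\mathcal H^u[V_n^m(w,f)](t)$, and let $\mathcal E^u_{n,m}(w,f,t)=|\mathcal H^uf(t)-\mathcal H^u_{n,m}(w,f,t)|$ be the quadrature error. With $c_+=\max\{0,c\}$ and $c_-=\max\{0,-c\}$ put $u_+=v^{a_+,b_+}$, $u_-=v^{a_-,b_-}$ (with $0^0=1$ at the endpoints), $$u_1=u_+,\qquad u_2(x)=\frac{u_-(x)}{1+(u_+u_-)(-1)\,|\log(1+x)|+(u_+u_-)(1)\,|\log(1-x)|}.$$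 Corollary 4.3. Let $c_2\ge c_1>1$, and write $m\approx n$ if $0<m<n$ and $c_1m\le n\le c_2m$. Assume that the maps $V_n^m(w):C^0_{u_1}\to C^0_{u_1}$, $m\approx n$, are uniformly bounded, i.e. there is $M$ with $\|V_n^m(w,f)u_1\|_\infty\le M\|fu_1\|_\infty$ for all $m\approx n$ and all $f\in C^0_{u_1}$. Let $r>0$. Then there is a constant $\mathcal C>0$, independent of $n,m,f,t$, such that for all $m\approx n$, all $f\in B_r(u_1)$ and all $t\in(-1,1)$ the limits defining $\mathcal H^uf(t)$ and $\mathcal H^u_{n,m}(w,f,t)$ exist (the truncated integrals being absolutely convergent) and $$\mathcal E^u_{n,m}(w,f,t)\,u_2(t)\le \mathcal C\,|f(t)-V_n^m(w,f,t)|\,u_1(t)+\mathcal C\,\frac{\log n}{n^r}\,\|f\|_{B_r(u_1)} .$$ -/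

import Mathlib

open Polynomial Filter Topology MeasureTheory

namespace FilteredHilbert

/-- The Jacobi weight `v^{γ,δ}(x) = (1-x)^γ (1+x)^δ` (used for `-1 < x < 1`, and at `±1` only for
nonnegative exponents, where `0 ^ 0 = 1`). -/
noncomputable def jacobiWeight (γ δ x : ℝ) : ℝ := (1 - x) ^ γ * (1 + x) ^ δ

/-! ### Weighted spaces of continuous functions and Besov type spaces

Functions on `(-1,1)` are represented by functions `ℝ → ℝ`; only their values on `(-1,1)` are used. -/

/-- `f ∈ C^0_v`, `v = v^{γ,δ}` with `γ, δ ≥ 0`: `f` is continuous on `(-1,1)`, and `f v` extends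
continuously to `[-1,1]`, with value `0` at `1` if `γ > 0` and with value `0` at `-1` if `δ > 0`. -/
def MemC0 (γ δ : ℝ) (f : ℝ → ℝ) : Prop :=
  ContinuousOn f (Set.Ioo (-1) 1) ∧
  (∃ l : ℝ, Tendsto (fun x => f x * jacobiWeight γ δ x) (𝓝[<] 1) (𝓝 l) ∧ (0 < γ → l = 0)) ∧
  (∃ l : ℝ, Tendsto (fun x => f x * jacobiWeight γ δ x) (𝓝[>] (-1)) (𝓝 l) ∧ (0 < δ → l = 0))

/-- The norm `‖f v‖_∞` of `C^0_v`. -/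
noncomputable def normC0 (γ δ : ℝ) (f : ℝ → ℝ) : ℝ :=
  ⨆ x : Set.Ioo (-1 : ℝ) 1, |f x| * jacobiWeight γ δ x

/-- The error `E_n(f)_v` of best approximation by polynomials of degree at most `n`. -/
noncomputable def bestError (γ δ : ℝ) (f : ℝ → ℝ) (n : ℕ) : ℝ :=
  ⨅ P : {P : ℝ[X] // P.natDegree ≤ n}, normC0 γ δ (fun x => f x - P.1.eval x)

/-- `f ∈ B_r(v)`: `f ∈ C^0_v` and `∑_{n ≥ 1} (n+1)^{r-1} E_n(f)_v < ∞`
(the summation index is shifted by one). -/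
def MemBesov (r γ δ : ℝ) (f : ℝ → ℝ) : Prop :=
  MemC0 γ δ f ∧
  Summable (fun n : ℕ => ((n : ℝ) + 2) ^ (r - 1) * bestError γ δ f (n + 1))

/-- `‖f‖_{B_r(v)} = ‖f v‖_∞ + ∑_{n ≥ 1} (n+1)^{r-1} E_n(f)_v`. -/
noncomputable def normBesov (r γ δ : ℝ) (f : ℝ → ℝ) : ℝ :=
  normC0 γ δ f + ∑' n : ℕ, ((n : ℝ) + 2) ^ (r - 1) * bestError γ δ f (n + 1)

/-! ### Orthonormal Jacobi polynomials and the filtered de la Vallée Poussin polynomial -/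

/-- `∫_{-1}^1 P Q w dx` with `w = v^{α,β}`. -/
noncomputable def jacobiInner (α β : ℝ) (P Q : ℝ[X]) : ℝ :=
  ∫ x in Set.Ioo (-1 : ℝ) 1, P.eval x * Q.eval x * jacobiWeight α β x

/-- Monic orthogonal polynomials for `w = v^{α,β}` (Gram–Schmidt on `1, X, X², …`). -/
noncomputable def monicOrtho (α β : ℝ) (n : ℕ) : ℝ[X] :=
  X ^ n - ∑ k : Fin n,
    C (jacobiInner α β (X ^ n) (monicOrtho α β k) /
      jacobiInner α β (monicOrtho α β k) (monicOrtho α β k)) * monicOrtho α β k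
termination_by n
decreasing_by all_goals exact k.2

/-- The orthonormal polynomial `p_n(w)`, of degree `n` with positive leading coefficient. -/
noncomputable def orthoPoly (α β : ℝ) (n : ℕ) : ℝ[X] :=
  C (Real.sqrt (jacobiInner α β (monicOrtho α β n) (monicOrtho α β n)))⁻¹ * monicOrtho α β n

/-- The node set `X_n(w)`: the zeros of `p_n(w)`. -/
noncomputable def nodes (α β : ℝ) (n : ℕ) : Finset ℝ := (orthoPoly α β n).roots.toFinset

/-- The Christoffel number `(∑_{j<n} p_j(w,y)²)⁻¹` of the node `y`. -/
noncomputable def christoffel (α β : ℝ) (n : ℕ) (y : ℝ) : ℝ :=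
  (∑ j ∈ Finset.range n, (orthoPoly α β j).eval y ^ 2)⁻¹

/-- The filter coefficients `μ_{n,j}^m`, for `0 < m < n` and `j < n + m`. -/
noncomputable def filterCoeff (n m j : ℕ) : ℝ :=
  if j ≤ n - m then 1 else ((n : ℝ) + m - j) / (2 * m)

/-- The filtered polynomial
`V_n^m(w,f) = ∑_k f(x_k) λ_k ∑_{j=0}^{n+m-1} μ_{n,j}^m p_j(w,x_k) p_j(w)`. -/
noncomputable def vpPoly (α β : ℝ) (n m : ℕ) (f : ℝ → ℝ) : ℝ[X] :=
  ∑ y ∈ nodes α β n, C (f y * christoffel α β n y) *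
    ∑ j ∈ Finset.range (n + m),
      C (filterCoeff n m j * (orthoPoly α β j).eval y) * orthoPoly α β j

/-- `0 < m < n` and `c₁ m ≤ n ≤ c₂ m`. -/
def Comparable (c₁ c₂ : ℝ) (n m : ℕ) : Prop :=
  0 < m ∧ m < n ∧ c₁ * m ≤ n ∧ (n : ℝ) ≤ c₂ * m

/-- `V_n^m(w) : C^0_v → C^0_v`, `w = v^{α,β}`, `v = v^{γ,δ}`, is bounded uniformly with respect to
all `n, m` with `0 < m < n` and `c₁ m ≤ n ≤ c₂ m`. -/
def VPUniformlyBounded (α β γ δ c₁ c₂ : ℝ) : Prop :=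
  ∃ M : ℝ, ∀ n m : ℕ, Comparable c₁ c₂ n m → ∀ f : ℝ → ℝ, MemC0 γ δ f →
    normC0 γ δ (fun x => (vpPoly α β n m f).eval x) ≤ M * normC0 γ δ f

/-! ### The finite Hilbert transform, the quadrature rule and its error -/

/-- The truncated integral `∫_{|x-t| ≥ ε} f(x) u(x) / (x - t) dx` over `(-1,1)`, `u = v^{a,b}`. -/
noncomputable def truncHilbert (a b : ℝ) (f : ℝ → ℝ) (t ε : ℝ) : ℝ :=
  ∫ x in {x : ℝ | x ∈ Set.Ioo (-1) 1 ∧ ε ≤ |x - t|}, f x / (x - t) * jacobiWeight a b x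

/-- The principal value integral defining `H^u f(t)` exists. -/
def HilbertExists (a b : ℝ) (f : ℝ → ℝ) (t : ℝ) : Prop :=
  (∀ ε : ℝ, 0 < ε → IntegrableOn (fun x => f x / (x - t) * jacobiWeight a b x)
    {x : ℝ | x ∈ Set.Ioo (-1) 1 ∧ ε ≤ |x - t|}) ∧
  ∃ L : ℝ, Tendsto (truncHilbert a b f t) (𝓝[>] 0) (𝓝 L)

/-- The finite Hilbert transform `H^u f(t)`, `u = v^{a,b}`. -/
noncomputable def hilbert (a b : ℝ) (f : ℝ → ℝ) (t : ℝ) : ℝ :=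
  limUnder (𝓝[>] 0) (truncHilbert a b f t)

/-- The quadrature rule `H^u_{n,m}(w,f,t) = H^u[V_n^m(w,f)](t)`, `u = v^{a,b}`, `w = v^{α,β}`. -/
noncomputable def vpRule (a b α β : ℝ) (n m : ℕ) (f : ℝ → ℝ) (t : ℝ) : ℝ :=
  hilbert a b (fun x => (vpPoly α β n m f).eval x) t

/-- The quadrature error `E^u_{n,m}(w,f,t)`. -/
noncomputable def quadError (a b α β : ℝ) (n m : ℕ) (f : ℝ → ℝ) (t : ℝ) : ℝ :=
  |hilbert a b f t - vpRule a b α β n m f t|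

/-- `u_+ = v^{a_+,b_+}`, which is also the weight `u_1`. -/
noncomputable def uPlus (a b x : ℝ) : ℝ := jacobiWeight (max 0 a) (max 0 b) x

/-- `u_- = v^{a_-,b_-}`. -/
noncomputable def uMinus (a b x : ℝ) : ℝ := jacobiWeight (max 0 (-a)) (max 0 (-b)) x

/-- The weight `u_2`. -/
noncomputable def uTwo (a b x : ℝ) : ℝ :=
  uMinus a b x /
    (1 + uPlus a b (-1) * uMinus a b (-1) * |Real.log (1 + x)|
      + uPlus a b 1 * uMinus a b 1 * |Real.log (1 - x)|)

end FilteredHilbert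

/-!
The error is the Hilbert transform of `R = f - V f`, where `V f` is the filtered polynomial, and the
idea is to write `R` as a telescoping series `R = ∑ D_j` of polynomials: `D_0 = P_0 - V f` and
`D_{j+1} = P_{j+1} - P_j`, where `P_j` is a near-best approximation of `f` of degree `2^j n`.

* The weighted norm of `D_j` is `O(2^{-jr} n^{-r})`. For the differences of the `P_j` this is the
  decay `E_k(f) = O(k^{-r})` of the best approximation errors (`bestError_mul_rpow_le`). For `V f` it
  follows from the uniform boundedness of `V` and from `V P = P` for `deg P ≤ n - m`
  (`vpPoly_eval_eq_self`), which is Gaussian quadrature (`moment_eq_sum_christoffel`): all the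
  products involved have degree at most `2n - 1`.
* A polynomial `P` of degree at most `N` satisfies `|H_ε P| u₂ ≤ C log N ‖P u₁‖` for all truncations
  `H_ε` of the Hilbert transform (`exists_truncHilbert_polynomial_bound`). Within distance
  `δ = (1 - t) / N²` of `t ≥ 0`, the singularity is cancelled by subtracting `P(t) u(t)` and Markov's
  inequality bounds the difference quotient. Between `δ` and `1 - t` the kernel `1 / |x - t|`
  contributes `log N`. The remaining part depends on the exponent of `u` at the endpoint: an
  algebraic singularity and a logarithm of `1 - t` are both absorbed by `u₂`, and for a positive
  exponent the logarithm of `1 - t` is replaced by `log N`, because `P` cannot grow by more than a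
  constant factor within distance `O(N⁻²)` of the endpoint (`abs_eval_le_of_extend`).
* Since the bound for the `H_ε` is uniform in `ε`, dominated convergence for the series shows that the
  principal value of `R` exists and `|H R| u₂ ≤ C ∑ log (2^{j+1} n) 2^{-jr} n^{-r}`, which is
  `O(n^{-r} log n)` (`exists_hilbert_series_bound`).
-/

namespace FilteredHilbert

/-! ### Integration of polynomials against a Jacobi weight -/

lemma jacobiWeight_pos (γ δ : ℝ) {x : ℝ} (hx : x ∈ Set.Ioo (-1 : ℝ) 1) :
    0 < jacobiWeight γ δ x :=
  mul_pos (Real.rpow_pos_of_pos (by linarith [hx.2]) _)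
    (Real.rpow_pos_of_pos (by linarith [hx.1]) _)

lemma continuousOn_jacobiWeight (γ δ : ℝ) :
    ContinuousOn (jacobiWeight γ δ) (Set.Ioo (-1 : ℝ) 1) := by
  intro x hx
  have h1 : 1 - x ≠ 0 := by linarith [hx.2]
  have h2 : 1 + x ≠ 0 := by linarith [hx.1]
  refine ContinuousAt.continuousWithinAt ?_
  unfold jacobiWeight
  exact ((continuousAt_const.sub continuousAt_id).rpow_const (Or.inl h1)).mul
    ((continuousAt_const.add continuousAt_id).rpow_const (Or.inl h2))

/-- The Jacobi weight is integrable on `(-1,1)` as soon as both exponents exceed `-1`. -/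
lemma integrableOn_jacobiWeight {γ δ : ℝ} (hγ : -1 < γ) (hδ : -1 < δ) :
    IntegrableOn (jacobiWeight γ δ) (Set.Ioo (-1 : ℝ) 1) := by
  have h1 : IntervalIntegrable (fun x : ℝ => (1 - x) ^ γ) volume 0 1 := by
    have h := (intervalIntegral.intervalIntegrable_rpow' (a := 0) (b := 1) hγ).comp_sub_left 1
    simpa using h.symm
  have h2 : IntervalIntegrable (fun x : ℝ => (1 + x) ^ δ) volume (-1) 0 := by
    have h := (intervalIntegral.intervalIntegrable_rpow' (a := 0) (b := 1) hδ).comp_add_right 1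
    simpa [add_comm] using h
  have h3 : IntervalIntegrable (jacobiWeight γ δ) volume 0 1 := by
    unfold jacobiWeight
    refine h1.mul_continuousOn (fun x hx => ContinuousAt.continuousWithinAt ?_)
    rw [Set.uIcc_of_le zero_le_one] at hx
    exact (continuousAt_const.add continuousAt_id).rpow_const
      (Or.inl (ne_of_gt (by linarith [hx.1] : (0 : ℝ) < 1 + x)))
  have h4 : IntervalIntegrable (jacobiWeight γ δ) volume (-1) 0 := by
    unfold jacobiWeight
    refine h2.continuousOn_mul (fun x hx => ContinuousAt.continuousWithinAt ?_)
    rw [Set.uIcc_of_le (by norm_num)] at hx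
    exact (continuousAt_const.sub continuousAt_id).rpow_const
      (Or.inl (ne_of_gt (by linarith [hx.2] : (0 : ℝ) < 1 - x)))
  exact ((intervalIntegrable_iff_integrableOn_Ioo_of_le (by norm_num)).1 (h4.trans h3))

lemma integrableOn_mul_jacobiWeight {γ δ : ℝ} (hγ : -1 < γ) (hδ : -1 < δ) {f : ℝ → ℝ}
    (hf : ContinuousOn f (Set.Icc (-1 : ℝ) 1)) :
    IntegrableOn (fun x => f x * jacobiWeight γ δ x) (Set.Ioo (-1 : ℝ) 1) := by
  have h := (intervalIntegrable_iff_integrableOn_Ioo_of_le (by norm_num : (-1 : ℝ) ≤ 1)).2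
    (integrableOn_jacobiWeight hγ hδ)
  exact (intervalIntegrable_iff_integrableOn_Ioo_of_le (by norm_num)).1
    (h.continuousOn_mul (by rwa [Set.uIcc_of_le (by norm_num)]))

/-- The moment functional `Q ↦ ∫ Q w` of the Jacobi weight `w = v^{α,β}`. -/
noncomputable def moment {α β : ℝ} (hα : -1 < α) (hβ : -1 < β) : ℝ[X] →ₗ[ℝ] ℝ where
  toFun Q := ∫ x in Set.Ioo (-1 : ℝ) 1, Q.eval x * jacobiWeight α β x
  map_add' P Q := by
    simp only [eval_add, add_mul]
    exact integral_add (integrableOn_mul_jacobiWeight hα hβ P.continuous.continuousOn)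
      (integrableOn_mul_jacobiWeight hα hβ Q.continuous.continuousOn)
  map_smul' c P := by
    simp only [eval_smul, smul_eq_mul, mul_assoc, RingHom.id_apply]
    exact integral_const_mul _ _

section Moment

variable {α β : ℝ} (hα : -1 < α) (hβ : -1 < β)
include hα hβ

lemma jacobiInner_eq_moment (P Q : ℝ[X]) : jacobiInner α β P Q = moment hα hβ (P * Q) := by
  simp [jacobiInner, moment]

lemma moment_C_mul (c : ℝ) (P : ℝ[X]) :
    moment hα hβ (C c * P) = c * moment hα hβ P := by
  rw [← smul_eq_C_mul, map_smul, smul_eq_mul]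

lemma moment_pos {Q : ℝ[X]} (hQ : Q ≠ 0) (h0 : ∀ x, 0 ≤ Q.eval x) : 0 < moment hα hβ Q := by
  change 0 < ∫ x in Set.Ioo (-1 : ℝ) 1, Q.eval x * jacobiWeight α β x
  have hint := integrableOn_mul_jacobiWeight hα hβ (f := fun x => Q.eval x)
    Q.continuous.continuousOn
  rw [setIntegral_pos_iff_support_of_nonneg_ae _ hint]
  · have hsub : Set.Ioo (-1 : ℝ) 1 \ (Q.roots.toFinset : Set ℝ) ⊆
        Function.support (fun x => Q.eval x * jacobiWeight α β x) ∩ Set.Ioo (-1 : ℝ) 1 := by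
      rintro x ⟨hx, hr⟩
      refine ⟨?_, hx⟩
      have : Q.eval x ≠ 0 := by simpa [hQ] using hr
      exact mul_ne_zero this (jacobiWeight_pos _ _ hx).ne'
    refine lt_of_lt_of_le ?_ (measure_mono hsub)
    rw [measure_sdiff_null (Finset.measure_zero _ _)]
    simp
  · refine (ae_restrict_iff' measurableSet_Ioo).2 (Eventually.of_forall fun x hx => ?_)
    exact mul_nonneg (h0 x) (jacobiWeight_pos _ _ hx).le

lemma moment_mul_self_pos {Q : ℝ[X]} (hQ : Q ≠ 0) : 0 < moment hα hβ (Q * Q) :=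
  moment_pos hα hβ (mul_ne_zero hQ hQ) fun x => by
    rw [eval_mul]; exact mul_self_nonneg _

/-! ### Orthonormal polynomials -/

omit hα hβ in
lemma monicOrtho_monic_natDegree (n : ℕ) :
    (monicOrtho α β n).Monic ∧ (monicOrtho α β n).natDegree = n := by
  induction n using Nat.strong_induction_on with
  | _ n ih =>
    have hdeg : (∑ k : Fin n,
        C (jacobiInner α β (X ^ n) (monicOrtho α β k) /
          jacobiInner α β (monicOrtho α β k) (monicOrtho α β k)) *
            monicOrtho α β k).degree < n := by
      refine lt_of_le_of_lt (degree_sum_le _ _) ?_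
      refine (Finset.sup_lt_iff (WithBot.bot_lt_coe n)).2 fun k _ => ?_
      rw [← smul_eq_C_mul]
      refine lt_of_le_of_lt (degree_smul_le _ _) ?_
      rw [degree_eq_natDegree (ih k k.2).1.ne_zero, (ih k k.2).2]
      exact Nat.cast_lt.2 k.2
    rw [monicOrtho]
    refine ⟨(monic_X_pow n).sub_of_left (by rwa [degree_X_pow]), ?_⟩
    refine natDegree_eq_of_degree_eq_some ?_
    rw [degree_sub_eq_left_of_degree_lt (by rwa [degree_X_pow]), degree_X_pow]

omit hα hβ in
lemma monicOrtho_ne_zero (n : ℕ) : monicOrtho α β n ≠ 0 :=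
  (monicOrtho_monic_natDegree n).1.ne_zero

lemma moment_monicOrtho_mul_of_lt (n : ℕ) : ∀ k < n,
    moment hα hβ (monicOrtho α β n * monicOrtho α β k) = 0 := by
  induction n using Nat.strong_induction_on with
  | _ n ih =>
    intro k hk
    have hne := (moment_mul_self_pos hα hβ (monicOrtho_ne_zero (α := α) (β := β) k)).ne'
    rw [monicOrtho, sub_mul, Finset.sum_mul, map_sub, map_sum]
    rw [Finset.sum_eq_single (⟨k, hk⟩ : Fin n)]
    · rw [mul_assoc, moment_C_mul, jacobiInner_eq_moment hα hβ, jacobiInner_eq_moment hα hβ,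
        div_mul_cancel₀ _ hne, sub_self]
    · intro i _ hik
      rw [mul_assoc, moment_C_mul]
      have hik' : (i : ℕ) ≠ k := fun h => hik (Fin.ext h)
      rcases lt_or_gt_of_ne hik' with h | h
      · rw [mul_comm (monicOrtho α β i), ih k hk i h, mul_zero]
      · rw [ih i i.2 k h, mul_zero]
    · simp

lemma moment_orthoPoly_mul (i j : ℕ) :
    moment hα hβ (orthoPoly α β i * orthoPoly α β j) = if i = j then 1 else 0 := by
  have hpos := moment_mul_self_pos hα hβ (monicOrtho_ne_zero (α := α) (β := β) i)
  unfold orthoPoly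
  rw [mul_mul_mul_comm, ← C_mul, moment_C_mul]
  split_ifs with h
  · subst h
    rw [jacobiInner_eq_moment hα hβ, ← mul_inv, Real.mul_self_sqrt hpos.le,
      inv_mul_cancel₀ hpos.ne']
  · rcases lt_or_gt_of_ne h with h | h
    · rw [mul_comm (monicOrtho α β i), moment_monicOrtho_mul_of_lt hα hβ j i h, mul_zero]
    · rw [moment_monicOrtho_mul_of_lt hα hβ i j h, mul_zero]

lemma natDegree_orthoPoly (n : ℕ) : (orthoPoly α β n).natDegree = n := by
  have hpos := moment_mul_self_pos hα hβ (monicOrtho_ne_zero (α := α) (β := β) n)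
  rw [orthoPoly, jacobiInner_eq_moment hα hβ, natDegree_C_mul
    (inv_ne_zero (Real.sqrt_pos.2 hpos).ne'), (monicOrtho_monic_natDegree n).2]

lemma orthoPoly_ne_zero (n : ℕ) : orthoPoly α β n ≠ 0 := by
  intro h
  have := moment_orthoPoly_mul hα hβ n n
  simp [h] at this

lemma exists_sum_orthoPoly (d : ℕ) : ∀ P : ℝ[X], P.degree < d →
    ∃ c : ℕ → ℝ, P = ∑ j ∈ Finset.range d, C (c j) * orthoPoly α β j := by
  induction d with
  | zero =>
    intro P hP
    refine ⟨0, ?_⟩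
    simpa [Nat.WithBot.lt_zero_iff] using hP
  | succ d ih =>
    intro P hP
    have hdeg : (orthoPoly α β d).degree = d := by
      rw [degree_eq_natDegree (orthoPoly_ne_zero hα hβ d), natDegree_orthoPoly hα hβ d]
    set c := P.coeff d / (orthoPoly α β d).leadingCoeff with hc
    have hlead : (orthoPoly α β d).leadingCoeff ≠ 0 :=
      leadingCoeff_ne_zero.2 (orthoPoly_ne_zero hα hβ d)
    have hP' : (P - C c * orthoPoly α β d).degree < d := by
      rw [degree_lt_iff_coeff_zero]
      intro m hm
      rcases hm.eq_or_lt with rfl | hm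
      · have : (orthoPoly α β d).coeff d = (orthoPoly α β d).leadingCoeff := by
          rw [leadingCoeff, natDegree_orthoPoly hα hβ]
        rw [coeff_sub, coeff_C_mul, this, hc, div_mul_cancel₀ _ hlead, sub_self]
      · rw [coeff_sub, coeff_C_mul,
          coeff_eq_zero_of_degree_lt (n := m) (p := P) (lt_of_lt_of_le hP (by exact_mod_cast hm)),
          coeff_eq_zero_of_natDegree_lt (by rwa [natDegree_orthoPoly hα hβ]), mul_zero, sub_zero]
    obtain ⟨e, he⟩ := ih _ hP'
    refine ⟨fun j => if j = d then c else e j, ?_⟩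
    rw [Finset.sum_range_succ]
    simp only [if_true]
    rw [← sub_eq_iff_eq_add, he]
    refine Finset.sum_congr rfl fun j hj => ?_
    rw [if_neg (Finset.mem_range.1 hj).ne]

/-- Fourier expansion of a polynomial in the orthonormal system. -/
lemma eq_sum_moment_mul_orthoPoly {d : ℕ} {P : ℝ[X]} (hP : P.degree < d) :
    P = ∑ j ∈ Finset.range d,
      C (moment hα hβ (P * orthoPoly α β j)) * orthoPoly α β j := by
  obtain ⟨c, hc⟩ := exists_sum_orthoPoly hα hβ d P hP
  conv_lhs => rw [hc]
  refine Finset.sum_congr rfl fun j hj => ?_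
  congr 2
  rw [hc, Finset.sum_mul, map_sum, Finset.sum_eq_single j]
  · rw [mul_assoc, moment_C_mul, moment_orthoPoly_mul, if_pos rfl, mul_one]
  · intro i _ hij
    rw [mul_assoc, moment_C_mul, moment_orthoPoly_mul, if_neg hij, mul_zero]
  · exact fun h => absurd hj h

lemma moment_mul_orthoPoly_of_degree_lt {n : ℕ} {P : ℝ[X]} (hP : P.degree < n) :
    moment hα hβ (P * orthoPoly α β n) = 0 := by
  obtain ⟨c, hc⟩ := exists_sum_orthoPoly hα hβ n P hP
  rw [hc, Finset.sum_mul, map_sum]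
  refine Finset.sum_eq_zero fun i hi => ?_
  rw [mul_assoc, moment_C_mul, moment_orthoPoly_mul, if_neg (Finset.mem_range.1 hi).ne, mul_zero]

/-! ### The zeros of the orthonormal polynomials -/

/-- A nonconstant polynomial that is nonnegative on `ℝ` cannot divide `p_n`: if `p_n = q s`, then
`∫ p_n s w = ∫ q s² w > 0`, although `s` has smaller degree than `p_n`. -/
lemma not_dvd_orthoPoly_of_nonneg {n : ℕ} {q : ℝ[X]} (hq : 0 < q.natDegree)
    (h0 : ∀ x, 0 ≤ q.eval x) : ¬ q ∣ orthoPoly α β n := by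
  rintro ⟨s, hs⟩
  have hne := orthoPoly_ne_zero hα hβ n
  have hs0 : s ≠ 0 := by rintro rfl; exact hne (by rw [hs, mul_zero])
  have hq0 : q ≠ 0 := by rintro rfl; simp at hq
  have hdeg : s.degree < n := by
    have h := natDegree_orthoPoly hα hβ n
    rw [hs, natDegree_mul hq0 hs0] at h
    rw [degree_eq_natDegree hs0]
    exact_mod_cast (by omega : s.natDegree < n)
  have h1 := moment_mul_orthoPoly_of_degree_lt hα hβ hdeg
  have h2 : 0 < moment hα hβ (s * orthoPoly α β n) := by
    rw [hs]
    refine moment_pos hα hβ (mul_ne_zero hs0 (mul_ne_zero hq0 hs0)) fun x => ?_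
    rw [eval_mul, eval_mul, mul_left_comm]
    exact mul_nonneg (h0 x) (mul_self_nonneg _)
  exact h2.ne' h1

lemma splits_orthoPoly (n : ℕ) : (orthoPoly α β n).Splits := by
  suffices H : ∀ q : ℝ[X], Irreducible q → q ∣ orthoPoly α β n → q.degree = 1 by
    obtain ⟨u, hu⟩ := UniqueFactorizationMonoid.factors_prod (orthoPoly_ne_zero hα hβ n)
    rw [← hu]
    refine (Splits.multisetProd fun g hg => Splits.of_degree_eq_one (H g ?_ ?_)).mul
      u.isUnit.splits
    · exact UniqueFactorizationMonoid.irreducible_of_factor g hg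
    · exact UniqueFactorizationMonoid.dvd_of_mem_factors hg
  intro q hirr hdvd
  by_contra hdeg
  have hroot : ∀ x, q.eval x ≠ 0 := fun x hx =>
    hdeg (degree_eq_one_of_irreducible_of_root hirr hx)
  have hpos : 0 < q.natDegree := hirr.natDegree_pos
  by_cases h : ∀ x, 0 ≤ q.eval x
  · exact not_dvd_orthoPoly_of_nonneg hα hβ hpos h hdvd
  · push Not at h
    obtain ⟨a, ha⟩ := h
    refine not_dvd_orthoPoly_of_nonneg hα hβ (q := -q) (by rwa [natDegree_neg]) (fun x => ?_)
      ((neg_dvd).2 hdvd)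
    by_contra hx
    rw [eval_neg, not_le, neg_lt_zero] at hx
    obtain ⟨y, -, hy⟩ := mem_range_of_exists_le_of_exists_ge (f := fun x => q.eval x) (c := 0)
      q.continuous ⟨a, ha.le⟩ ⟨x, hx.le⟩ |>.imp fun y hy => (⟨trivial, hy⟩ : True ∧ _)
    exact hroot y hy

lemma nodup_roots_orthoPoly (n : ℕ) : (orthoPoly α β n).roots.Nodup := by
  rw [Multiset.nodup_iff_count_le_one]
  intro a
  rw [count_roots]
  by_contra h
  push Not at h
  have hdvd : (X - C a) ^ 2 ∣ orthoPoly α β n :=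
    (le_rootMultiplicity_iff (orthoPoly_ne_zero hα hβ n)).1 h
  refine not_dvd_orthoPoly_of_nonneg hα hβ ?_ (fun x => ?_) hdvd
  · rw [natDegree_pow, natDegree_X_sub_C]; norm_num
  · rw [eval_pow]; exact sq_nonneg _

lemma card_nodes (n : ℕ) : (nodes α β n).card = n := by
  rw [nodes, Multiset.toFinset_card_of_nodup (nodup_roots_orthoPoly hα hβ n),
    ← (splits_orthoPoly hα hβ n).natDegree_eq_card_roots, natDegree_orthoPoly hα hβ n]

lemma eval_orthoPoly_of_mem_nodes {n : ℕ} {y : ℝ} (hy : y ∈ nodes α β n) :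
    (orthoPoly α β n).eval y = 0 := by
  simpa [nodes, orthoPoly_ne_zero hα hβ n] using hy

/-! ### Gaussian quadrature -/

/-- Exactness of the interpolatory rule at the zeros of `p_n` in degrees up to `2n - 1`. -/
lemma moment_eq_sum_basis {n : ℕ} {P : ℝ[X]} (hP : P.degree < (2 * n : ℕ)) :
    moment hα hβ P = ∑ y ∈ nodes α β n,
      P.eval y * moment hα hβ (Lagrange.basis (nodes α β n) id y) := by
  have hp0 := orthoPoly_ne_zero hα hβ n
  have hpd : (orthoPoly α β n).degree = n := by
    rw [degree_eq_natDegree hp0, natDegree_orthoPoly hα hβ n]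
  set q := P / orthoPoly α β n with hq
  set s := P % orthoPoly α β n with hs
  have hdecomp : orthoPoly α β n * q + s = P := EuclideanDomain.div_add_mod _ _
  have hsdeg : s.degree < n := hpd ▸ degree_mod_lt P hp0
  have hqdeg : q.degree < n := by
    by_cases hq0 : q = 0
    · rw [hq0, degree_zero]; exact WithBot.bot_lt_coe n
    have hle : (orthoPoly α β n).degree ≤ P.degree := by
      by_contra hlt
      exact hq0 ((Polynomial.div_eq_zero_iff hp0).2 (not_le.1 hlt))
    have hP0 : P ≠ 0 := by rintro rfl; exact hq0 (by simp [hq])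
    have h1 := degree_add_div hp0 hle
    rw [degree_eq_natDegree hp0, natDegree_orthoPoly hα hβ n, ← hq, degree_eq_natDegree hq0,
      degree_eq_natDegree hP0] at h1
    rw [degree_eq_natDegree hP0] at hP
    have hP' : P.natDegree < 2 * n := by exact_mod_cast hP
    have h1' : n + q.natDegree = P.natDegree := by exact_mod_cast h1
    rw [degree_eq_natDegree hq0]
    exact_mod_cast (by omega : q.natDegree < n)
  have hmP : moment hα hβ P = moment hα hβ s := by
    rw [← hdecomp, map_add, mul_comm, moment_mul_orthoPoly_of_degree_lt hα hβ hqdeg, zero_add]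
  have hinterp := Lagrange.eq_interpolate (s := nodes α β n) (v := id) (f := s)
    (Set.injOn_id _) (by rwa [card_nodes hα hβ n])
  rw [hmP]
  conv_lhs => rw [hinterp]
  rw [Lagrange.interpolate_apply, map_sum]
  refine Finset.sum_congr rfl fun y hy => ?_
  rw [moment_C_mul, ← hdecomp, eval_add, eval_mul, eval_orthoPoly_of_mem_nodes hα hβ hy, zero_mul,
    zero_add, id]

omit hα hβ in
lemma eval_basis_nodes {n : ℕ} {y z : ℝ} (hy : y ∈ nodes α β n) (hz : z ∈ nodes α β n) :
    (Lagrange.basis (nodes α β n) id y).eval z = if z = y then 1 else 0 := by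
  split_ifs with h
  · subst h
    exact Lagrange.eval_basis_self (v := id) (Set.injOn_id _) hy
  · exact Lagrange.eval_basis_of_ne (v := id) (Ne.symm h) hz

/-- The Christoffel numbers are the weights of the interpolatory rule: evaluate at `y` the Fourier
expansion of the fundamental Lagrange polynomial of the node `y`. -/
lemma moment_basis_eq_christoffel {n : ℕ} {y : ℝ} (hy : y ∈ nodes α β n) :
    moment hα hβ (Lagrange.basis (nodes α β n) id y) = christoffel α β n y := by
  set ℓ := Lagrange.basis (nodes α β n) id y with hℓ
  have hn : 0 < n := by
    rw [← card_nodes hα hβ n]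
    exact Finset.card_pos.2 ⟨y, hy⟩
  have hdeg : ℓ.degree < n := by
    rw [hℓ, Lagrange.degree_basis (Set.injOn_id _) hy, card_nodes hα hβ n]
    exact_mod_cast Nat.sub_lt hn one_pos
  have hcoef : ∀ j ∈ Finset.range n, moment hα hβ (ℓ * orthoPoly α β j) =
      (orthoPoly α β j).eval y * moment hα hβ ℓ := by
    intro j hj
    have hjn := Finset.mem_range.1 hj
    have hd : (ℓ * orthoPoly α β j).degree < (2 * n : ℕ) := by
      by_cases hℓ0 : ℓ = 0
      · rw [hℓ0, zero_mul, degree_zero]; exact WithBot.bot_lt_coe _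
      rw [degree_eq_natDegree hℓ0] at hdeg
      have hdeg' : ℓ.natDegree < n := by exact_mod_cast hdeg
      rw [degree_eq_natDegree (mul_ne_zero hℓ0 (orthoPoly_ne_zero hα hβ j)),
        natDegree_mul hℓ0 (orthoPoly_ne_zero hα hβ j), natDegree_orthoPoly hα hβ]
      exact_mod_cast (by omega : ℓ.natDegree + j < 2 * n)
    rw [moment_eq_sum_basis hα hβ hd, Finset.sum_eq_single y]
    · rw [eval_mul, eval_basis_nodes hy hy, if_pos rfl, one_mul]
    · intro z hz hzy
      rw [eval_mul, eval_basis_nodes hy hz, if_neg hzy, zero_mul, zero_mul]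
    · exact fun h => absurd hy h
  have h1 : ℓ.eval y = 1 := by rw [hℓ, eval_basis_nodes hy hy, if_pos rfl]
  have h2 := eq_sum_moment_mul_orthoPoly hα hβ hdeg
  have h3 : (1 : ℝ) = moment hα hβ ℓ * ∑ j ∈ Finset.range n, (orthoPoly α β j).eval y ^ 2 := by
    rw [← h1]
    conv_lhs => rw [h2]
    rw [eval_finsetSum, Finset.mul_sum]
    refine Finset.sum_congr rfl fun j hj => ?_
    rw [eval_mul, eval_C, hcoef j hj]
    ring
  rw [christoffel]
  exact eq_inv_of_mul_eq_one_left h3.symm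

/-- **Gaussian quadrature**: the Christoffel numbers integrate polynomials of degree at most
`2n - 1` exactly. -/
lemma moment_eq_sum_christoffel {n : ℕ} {P : ℝ[X]} (hP : P.degree < (2 * n : ℕ)) :
    moment hα hβ P = ∑ y ∈ nodes α β n, P.eval y * christoffel α β n y := by
  rw [moment_eq_sum_basis hα hβ hP]
  exact Finset.sum_congr rfl fun y hy => by rw [moment_basis_eq_christoffel hα hβ hy]

/-! ### The filtered polynomial -/

/-- `V_n^m` reproduces the polynomials of degree at most `n - m`. -/
lemma vpPoly_eval_eq_self {n m : ℕ} (hm : 0 < m) (hmn : m < n) {P : ℝ[X]}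
    (hP : P.natDegree ≤ n - m) : vpPoly α β n m (fun x => P.eval x) = P := by
  have hcoef : ∀ j ∈ Finset.range (n + m), ∑ y ∈ nodes α β n,
      P.eval y * christoffel α β n y * (orthoPoly α β j).eval y =
        moment hα hβ (P * orthoPoly α β j) := by
    intro j hj
    have hj' := Finset.mem_range.1 hj
    rw [moment_eq_sum_christoffel hα hβ (n := n)]
    · exact Finset.sum_congr rfl fun y _ => by rw [eval_mul]; ring
    · refine lt_of_le_of_lt degree_le_natDegree ?_
      refine lt_of_le_of_lt (Nat.cast_le.2 natDegree_mul_le) ?_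
      rw [natDegree_orthoPoly hα hβ]
      exact_mod_cast (by omega : P.natDegree + j < 2 * n)
  have hdeg : P.degree < (n + m : ℕ) :=
    lt_of_le_of_lt degree_le_natDegree (by exact_mod_cast (by omega : P.natDegree < n + m))
  unfold vpPoly
  simp only [Finset.mul_sum]
  rw [Finset.sum_comm]
  conv_rhs => rw [eq_sum_moment_mul_orthoPoly hα hβ hdeg]
  refine Finset.sum_congr rfl fun j hj => ?_
  have : ∀ y ∈ nodes α β n, C (P.eval y * christoffel α β n y) *
      (C (filterCoeff n m j * (orthoPoly α β j).eval y) * orthoPoly α β j) =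
      C (filterCoeff n m j) *
        (C (P.eval y * christoffel α β n y * (orthoPoly α β j).eval y) * orthoPoly α β j) := by
    intro y _
    simp only [C_mul]
    ring
  rw [Finset.sum_congr rfl this, ← Finset.mul_sum, ← Finset.sum_mul, ← map_sum, hcoef j hj]
  by_cases hjn : j ≤ n - m
  · rw [filterCoeff, if_pos hjn, C_1, one_mul]
  · have : moment hα hβ (P * orthoPoly α β j) = 0 :=
      moment_mul_orthoPoly_of_degree_lt hα hβ (lt_of_le_of_lt degree_le_natDegree
        (by exact_mod_cast (by omega : P.natDegree < j)))
    rw [this, C_0, zero_mul, mul_zero]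

lemma natDegree_vpPoly_le {n m : ℕ} (hmn : m < n) (f : ℝ → ℝ) :
    (vpPoly α β n m f).natDegree ≤ 2 * n := by
  unfold vpPoly
  refine natDegree_sum_le_of_forall_le _ _ fun y _ => ?_
  refine (natDegree_C_mul_le _ _).trans ?_
  refine natDegree_sum_le_of_forall_le _ _ fun j hj => ?_
  refine (natDegree_C_mul_le _ _).trans ?_
  rw [natDegree_orthoPoly hα hβ]
  have := Finset.mem_range.1 hj
  omega

end Moment

lemma vpPoly_sub (α β : ℝ) (n m : ℕ) (f g : ℝ → ℝ) :
    vpPoly α β n m (fun x => f x - g x) = vpPoly α β n m f - vpPoly α β n m g := by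
  simp only [vpPoly, sub_mul, C_sub, Finset.sum_sub_distrib]

/-! ### Markov's inequality -/

/-- Markov's inequality at the end `z` of the segment joining `w` and `z`, in either order. -/
lemma abs_derivative_eval_le_of_segment {N : ℕ} {P : ℝ[X]} (hP : P.natDegree ≤ N) {w z M : ℝ}
    (hwz : w ≠ z) (hM : 0 < M) (hb : ∀ x ∈ Set.uIcc w z, |P.eval x| ≤ M) :
    |P.derivative.eval z| ≤ 2 * N ^ 2 / |z - w| * M := by
  set q := (z - w) / 2 with hq
  have hq0 : 0 < |q| := abs_pos.2 (div_ne_zero (sub_ne_zero.2 hwz.symm) two_ne_zero)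
  have key : ∀ c : ℝ, |c| = M⁻¹ → c * (q * P.derivative.eval z) ≤ N ^ 2 := by
    intro c hc
    set Q : ℝ[X] := C c * P.comp (C q * X + C ((z + w) / 2)) with hQ
    have hlin : (C q * X + C ((z + w) / 2) : ℝ[X]).natDegree ≤ 1 := natDegree_linear_le
    have hdeg : Q.degree ≤ N := by
      refine degree_le_of_natDegree_le ((natDegree_C_mul_le _ _).trans ?_)
      rw [natDegree_comp]
      calc P.natDegree * _ ≤ P.natDegree * 1 := Nat.mul_le_mul_left _ hlin
        _ ≤ N := by simpa using hP
    have hbd : ∀ x ∈ Set.Icc (-1 : ℝ) 1, |Q.eval x| ≤ 1 := by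
      intro x hx
      rw [hQ, eval_mul, eval_C, eval_comp, abs_mul, hc]
      have hmem : (C q * X + C ((z + w) / 2)).eval x ∈ Set.uIcc w z := by
        simp only [eval_add, eval_mul, eval_C, eval_X, hq]
        rw [Set.mem_uIcc]
        rcases le_total w z with h | h
        · left
          constructor <;> nlinarith [hx.1, hx.2]
        · right
          constructor <;> nlinarith [hx.1, hx.2]
      calc M⁻¹ * _ ≤ M⁻¹ * M := mul_le_mul_of_nonneg_left (hb _ hmem) (inv_nonneg.2 hM.le)
        _ = 1 := inv_mul_cancel₀ hM.ne'
    have h := Chebyshev.eval_iterate_derivative_le_of_forall_abs_le_one (k := 1) le_rfl hdeg hbd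
    have hT := Chebyshev.iterate_derivative_T_eval_one (R := ℝ) N 1
    simp only [Finset.range_one, Finset.prod_singleton, Nat.cast_zero] at hT
    have hval : (derivative^[1] Q).eval 1 = c * (q * P.derivative.eval z) := by
      have : q * 1 + (z + w) / 2 = z := by rw [hq]; ring
      simp only [Function.iterate_one, hQ, derivative_mul, derivative_C, zero_mul, zero_add,
        derivative_comp, eval_mul, eval_C, eval_comp, eval_add, eval_X, derivative_add,
        derivative_X, mul_one, add_zero]
      rw [mul_one] at this
      rw [this]
    rw [hval] at h
    refine h.trans (le_of_eq ?_)
    push_cast at hT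
    simpa using hT
  have h1 := key M⁻¹ (abs_of_pos (inv_pos.2 hM))
  have h2 := key (-M⁻¹) (by rw [abs_neg, abs_of_pos (inv_pos.2 hM)])
  have h3 : M⁻¹ * (|q| * |P.derivative.eval z|) ≤ N ^ 2 := by
    rw [← abs_mul, ← abs_of_pos (inv_pos.2 hM), ← abs_mul, abs_le]
    constructor <;> linarith
  have h4 : |z - w| = 2 * |q| := by
    rw [hq, abs_div, abs_two]; ring
  rw [inv_mul_le_iff₀ hM] at h3
  rw [h4, div_mul_eq_mul_div, le_div_iff₀ (by positivity)]
  linarith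

/-- Markov's inequality on `[c,d]`, up to the constant: the estimate at an end point is applied on
the longer of `[c,x]` and `[x,d]`. -/
lemma abs_derivative_eval_le {N : ℕ} {P : ℝ[X]} (hP : P.natDegree ≤ N) {c d M : ℝ}
    (hcd : c < d) (hM : 0 < M) (hb : ∀ x ∈ Set.Icc c d, |P.eval x| ≤ M) {x : ℝ}
    (hx : x ∈ Set.Icc c d) : |P.derivative.eval x| ≤ 4 * N ^ 2 / (d - c) * M := by
  have aux : ∀ w ∈ Set.Icc c d, (d - c) / 2 ≤ |x - w| →
      |P.derivative.eval x| ≤ 4 * N ^ 2 / (d - c) * M := by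
    intro w hw hlen
    have hpos : 0 < (d - c) / 2 := by linarith
    have hne : w ≠ x := by
      rintro rfl
      rw [sub_self, abs_zero] at hlen
      linarith
    have h := abs_derivative_eval_le_of_segment hP hne hM
      fun y hy => hb y (Set.ordConnected_Icc.uIcc_subset hw hx hy)
    refine h.trans (mul_le_mul_of_nonneg_right ?_ hM.le)
    calc 2 * (N : ℝ) ^ 2 / |x - w| ≤ 2 * (N : ℝ) ^ 2 / ((d - c) / 2) := by gcongr
      _ = 4 * N ^ 2 / (d - c) := by field_simp; ring
  rcases le_total (x - c) (d - x) with h | h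
  · refine aux d ⟨hcd.le, le_rfl⟩ ?_
    rw [abs_sub_comm, abs_of_nonneg (by linarith [hx.2])]
    linarith
  · refine aux c ⟨le_rfl, hcd.le⟩ ?_
    rw [abs_of_nonneg (by linarith [hx.1])]
    linarith

/-- A polynomial of degree `N` at most doubles its maximum when an interval is extended by a
fraction `1 / (8 N²)` of its length: by Markov's inequality on the larger interval, the maximum
there exceeds the old one by at most half of itself. -/
lemma abs_eval_le_of_extend {N : ℕ} {P : ℝ[X]} (hP : P.natDegree ≤ N) {c d h M : ℝ}
    (hcd : c < d) (hh : 0 ≤ h) (hhN : 8 * N ^ 2 * h ≤ d - c) (hM : 0 < M)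
    (hb : ∀ x ∈ Set.Icc c d, |P.eval x| ≤ M) {x : ℝ} (hx : x ∈ Set.Icc c (d + h)) :
    |P.eval x| ≤ 2 * M := by
  obtain ⟨z, hz, hmax⟩ := isCompact_Icc.exists_isMaxOn (s := Set.Icc c (d + h))
    (f := fun x => |P.eval x|) ⟨c, le_rfl, by linarith⟩ P.continuous.abs.continuousOn
  have hmax' : ∀ y ∈ Set.Icc c (d + h), |P.eval y| ≤ |P.eval z| := fun y hy => hmax hy
  refine (hmax' x hx).trans ?_
  by_cases hzd : z ≤ d
  · linarith [hb z ⟨hz.1, hzd⟩]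
  push Not at hzd
  by_contra hlt
  push Not at hlt
  have hzpos : 0 < |P.eval z| := by linarith
  have hder : ∀ y ∈ Set.Icc d z, ‖P.derivative.eval y‖ ≤ 4 * N ^ 2 / (d - c) * |P.eval z| := by
    intro y hy
    refine (abs_derivative_eval_le hP (by linarith : c < d + h) hzpos hmax'
      ⟨hcd.le.trans hy.1, hy.2.trans hz.2⟩).trans ?_
    refine mul_le_mul_of_nonneg_right ?_ hzpos.le
    exact div_le_div_of_nonneg_left (by positivity) (by linarith) (by linarith)
  have hmv := (convex_Icc d z).norm_image_sub_le_of_norm_hasDerivWithin_le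
    (f := fun x => P.eval x) (fun y _ => (P.hasDerivAt y).hasDerivWithinAt) hder
    (Set.left_mem_Icc.2 hzd.le) (Set.right_mem_Icc.2 hzd.le)
  rw [Real.norm_eq_abs, Real.norm_eq_abs, abs_of_pos (by linarith : 0 < z - d)] at hmv
  have h1 : |P.eval z| ≤ |P.eval z - P.eval d| + |P.eval d| := by
    have := abs_add_le (P.eval z - P.eval d) (P.eval d)
    simpa using this
  have h2 : 4 * (N : ℝ) ^ 2 / (d - c) * |P.eval z| * (z - d) ≤ |P.eval z| / 2 := by
    have hdc : 0 < d - c := by linarith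
    have h3 : 4 * (N : ℝ) ^ 2 / (d - c) * (z - d) ≤ 1 / 2 := by
      rw [div_mul_eq_mul_div, div_le_iff₀ hdc]
      have : 4 * (N : ℝ) ^ 2 * (z - d) ≤ 4 * (N : ℝ) ^ 2 * h :=
        mul_le_mul_of_nonneg_left (by linarith [hz.2]) (by positivity)
      linarith
    calc _ = 4 * (N : ℝ) ^ 2 / (d - c) * (z - d) * |P.eval z| := by ring
      _ ≤ 1 / 2 * |P.eval z| := mul_le_mul_of_nonneg_right h3 hzpos.le
      _ = |P.eval z| / 2 := by ring
  linarith [hb d ⟨hcd.le, le_rfl⟩]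

/-! ### The truncated integrals of a regularized kernel -/

/-- The kernel `F(x) / (x - t)`, with `F(t)` subtracted from `F(x)` at distance less than `δ` from
the singularity. By oddness this does not change symmetric truncated integrals. -/
noncomputable def regularizedKernel (F : ℝ → ℝ) (t δ x : ℝ) : ℝ :=
  (F x - if |x - t| < δ then F t else 0) / (x - t)

lemma measurableSet_truncation (t ε : ℝ) :
    MeasurableSet {x : ℝ | x ∈ Set.Ioo (-1) 1 ∧ ε ≤ |x - t|} := by
  have h : MeasurableSet {x : ℝ | ε ≤ |x - t|} := measurableSet_le measurable_const (by fun_prop)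
  exact measurableSet_Ioo.inter h

lemma integral_indicator_inv_sub (t ε δ : ℝ) :
    ∫ x, {x : ℝ | ε ≤ |x - t| ∧ |x - t| < δ}.indicator (fun x => (x - t)⁻¹) x = 0 := by
  set h : ℝ → ℝ := {x : ℝ | ε ≤ |x - t| ∧ |x - t| < δ}.indicator (fun x => (x - t)⁻¹) with hh
  have hodd : ∀ x, h (2 * t - x) = -h x := by
    intro x
    have h1 : |2 * t - x - t| = |x - t| := by rw [← abs_neg]; congr 1; ring
    simp only [hh, Set.indicator_apply, Set.mem_ofPred_eq, h1]
    split_ifs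
    · rw [← inv_neg]; congr 1; ring
    · simp
  have h2 := integral_sub_left_eq_self h volume (2 * t)
  simp only [hodd, integral_neg] at h2
  linarith

lemma aestronglyMeasurable_regularizedKernel {F : ℝ → ℝ} (hF : ContinuousOn F (Set.Ioo (-1) 1))
    (t δ : ℝ) :
    AEStronglyMeasurable (regularizedKernel F t δ) (volume.restrict (Set.Ioo (-1 : ℝ) 1)) := by
  unfold regularizedKernel
  have h1 : AEStronglyMeasurable F (volume.restrict (Set.Ioo (-1 : ℝ) 1)) :=
    hF.aestronglyMeasurable measurableSet_Ioo
  have h2 : Measurable (fun x : ℝ => if |x - t| < δ then F t else 0) :=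
    Measurable.ite (measurableSet_lt (by fun_prop) measurable_const) measurable_const
      measurable_const
  have h3 : Measurable (fun x : ℝ => (x - t)⁻¹) := by fun_prop
  simp only [div_eq_mul_inv]
  exact (h1.sub h2.aestronglyMeasurable).mul h3.aestronglyMeasurable

/-- Truncated integrals are integrals of the regularized kernel. -/
lemma truncHilbert_eq_integral_regularizedKernel {a b : ℝ} {f : ℝ → ℝ} {t δ ε : ℝ}
    (hsub : ∀ x, |x - t| < δ → x ∈ Set.Ioo (-1 : ℝ) 1) (hε : 0 < ε)
    (hint : IntegrableOn (regularizedKernel (fun x => f x * jacobiWeight a b x) t δ)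
      (Set.Ioo (-1) 1)) :
    IntegrableOn (fun x => f x / (x - t) * jacobiWeight a b x)
        {x : ℝ | x ∈ Set.Ioo (-1) 1 ∧ ε ≤ |x - t|} ∧
      truncHilbert a b f t ε = ∫ x in {x : ℝ | x ∈ Set.Ioo (-1) 1 ∧ ε ≤ |x - t|},
        regularizedKernel (fun x => f x * jacobiWeight a b x) t δ x := by
  set S : Set ℝ := {x : ℝ | x ∈ Set.Ioo (-1) 1 ∧ ε ≤ |x - t|} with hS
  have hSm : MeasurableSet S := measurableSet_truncation t ε
  set T : Set ℝ := {x : ℝ | ε ≤ |x - t| ∧ |x - t| < δ} with hT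
  have hTm : MeasurableSet T := by
    have h1 : MeasurableSet {x : ℝ | ε ≤ |x - t|} := measurableSet_le measurable_const (by fun_prop)
    have h2 : MeasurableSet {x : ℝ | |x - t| < δ} := measurableSet_lt (by fun_prop) measurable_const
    exact h1.inter h2
  set F : ℝ → ℝ := fun x => f x * jacobiWeight a b x with hF
  set k : ℝ → ℝ := T.indicator (fun x => (x - t)⁻¹) with hk
  have hgS : IntegrableOn (regularizedKernel F t δ) S := hint.mono_set fun x hx => hx.1
  have hkS : IntegrableOn k S := by
    have hfin : volume S ≠ ⊤ :=
      ne_top_of_le_ne_top (measure_Ioo_lt_top (a := (-1 : ℝ)) (b := 1)).ne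
        (measure_mono fun x hx => hx.1)
    refine Measure.integrableOn_of_bounded (M := ε⁻¹) hfin ?_ ?_
    · exact ((by fun_prop : Measurable fun x : ℝ => (x - t)⁻¹).indicator hTm).aestronglyMeasurable
    · refine Eventually.of_forall fun x => ?_
      simp only [hk, Set.indicator_apply]
      split_ifs with h
      · rw [norm_inv, Real.norm_eq_abs]
        exact inv_anti₀ hε h.1
      · simpa using hε.le
  have heq : ∀ x ∈ S, f x / (x - t) * jacobiWeight a b x =
      regularizedKernel F t δ x + F t * k x := by
    intro x hx
    simp only [regularizedKernel, hk, Set.indicator_apply, hT, Set.mem_ofPred_eq, hx.2, true_and]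
    split_ifs
    · simp only [hF]; ring
    · simp only [hF]; ring
  have hk0 : ∫ x in S, k x = 0 := by
    rw [hk, setIntegral_indicator hTm]
    have : S ∩ T = T := by
      ext x
      exact ⟨fun h => h.2, fun h => ⟨⟨hsub x h.2, h.1⟩, h⟩⟩
    rw [this, ← integral_indicator hTm]
    exact integral_indicator_inv_sub t ε δ
  refine ⟨(hgS.add (hkS.const_mul (F t))).congr_fun (fun x hx => (heq x hx).symm) hSm, ?_⟩
  rw [truncHilbert, setIntegral_congr_fun hSm heq, integral_add hgS (hkS.const_mul _),
    integral_const_mul, hk0, mul_zero, add_zero]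

/-- If the regularized kernel has `L¹` norm at most `K`, then the principal value exists and all
truncated integrals are bounded by `K`. -/
lemma hilbertExists_of_lintegral_le {a b : ℝ} {f : ℝ → ℝ} {t δ K : ℝ}
    (hf : ContinuousOn f (Set.Ioo (-1) 1))
    (hsub : ∀ x, |x - t| < δ → x ∈ Set.Ioo (-1 : ℝ) 1) (hK0 : 0 ≤ K)
    (hK : ∫⁻ x in Set.Ioo (-1 : ℝ) 1, ENNReal.ofReal
      |regularizedKernel (fun x => f x * jacobiWeight a b x) t δ x| ≤ ENNReal.ofReal K) :
    HilbertExists a b f t ∧ ∀ ε, 0 < ε → |truncHilbert a b f t ε| ≤ K := by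
  set g := regularizedKernel (fun x => f x * jacobiWeight a b x) t δ with hg
  have hmeas : AEStronglyMeasurable g (volume.restrict (Set.Ioo (-1 : ℝ) 1)) :=
    aestronglyMeasurable_regularizedKernel (hf.mul (continuousOn_jacobiWeight a b)) t δ
  have hint : IntegrableOn g (Set.Ioo (-1) 1) := by
    refine ⟨hmeas, ?_⟩
    rw [hasFiniteIntegral_iff_norm]
    exact lt_of_le_of_lt hK ENNReal.ofReal_lt_top
  have hnorm : ∫ x in Set.Ioo (-1 : ℝ) 1, |g x| ≤ K := by
    rw [integral_eq_lintegral_of_nonneg_ae (Eventually.of_forall fun x => abs_nonneg _)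
      hmeas.norm]
    exact ENNReal.toReal_le_of_le_ofReal hK0 hK
  refine ⟨⟨fun ε hε => (truncHilbert_eq_integral_regularizedKernel hsub hε hint).1,
    ∫ x in Set.Ioo (-1 : ℝ) 1, g x, ?_⟩, fun ε hε => ?_⟩
  · have heq : (fun ε => ∫ x in Set.Ioo (-1 : ℝ) 1, {x : ℝ | ε ≤ |x - t|}.indicator g x)
        =ᶠ[𝓝[>] 0] truncHilbert a b f t := by
      filter_upwards [self_mem_nhdsWithin] with ε hε
      rw [(truncHilbert_eq_integral_regularizedKernel hsub hε hint).2, setIntegral_indicator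
        (measurableSet_le measurable_const (by fun_prop))]
      rfl
    refine Tendsto.congr' heq ?_
    refine tendsto_integral_filter_of_dominated_convergence (fun x => |g x|) ?_ ?_ hint.norm ?_
    · exact Eventually.of_forall fun ε =>
        hmeas.indicator (measurableSet_le measurable_const (by fun_prop))
    · exact Eventually.of_forall fun ε => Eventually.of_forall fun x =>
        norm_indicator_le_norm_self _ _
    · have hne : ∀ᵐ x ∂(volume.restrict (Set.Ioo (-1 : ℝ) 1)), x ≠ t :=
        ae_restrict_of_ae (by simp [ae_iff])
      filter_upwards [hne] with x hx
      have hpos : 0 < |x - t| := abs_pos.2 (sub_ne_zero.2 hx)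
      refine tendsto_const_nhds.congr' ?_
      filter_upwards [Ioo_mem_nhdsGT hpos] with ε hε
      rw [Set.indicator_of_mem]
      exact hε.2.le
  · rw [(truncHilbert_eq_integral_regularizedKernel hsub hε hint).2]
    have h1 : ∫ x in {x : ℝ | x ∈ Set.Ioo (-1) 1 ∧ ε ≤ |x - t|}, |g x| ≤
        ∫ x in Set.Ioo (-1 : ℝ) 1, |g x| :=
      setIntegral_mono_set hint.norm (Eventually.of_forall fun x => abs_nonneg (g x))
        (Eventually.of_forall fun x hx => hx.1)
    exact (norm_integral_le_integral_norm (fun x => g x)).trans (h1.trans hnorm)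

/-! ### Integrals of powers -/

lemma setLIntegral_comp_sub_left (φ : ℝ → ENNReal) (c : ℝ) {S : Set ℝ} (hS : MeasurableSet S) :
    ∫⁻ x in {x | c - x ∈ S}, φ (c - x) = ∫⁻ y in S, φ y := by
  have hm : MeasurableSet {x | c - x ∈ S} := hS.preimage (by fun_prop)
  rw [← lintegral_indicator hm, ← lintegral_indicator hS,
    ← lintegral_sub_left_eq_self (S.indicator φ) c]
  rfl

lemma setLIntegral_comp_sub_right (φ : ℝ → ENNReal) (c : ℝ) {S : Set ℝ} (hS : MeasurableSet S) :
    ∫⁻ x in {x | x - c ∈ S}, φ (x - c) = ∫⁻ y in S, φ y := by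
  have hm : MeasurableSet {x | x - c ∈ S} := hS.preimage (by fun_prop)
  rw [← lintegral_indicator hm, ← lintegral_indicator hS,
    ← lintegral_sub_right_eq_self (S.indicator φ) c]
  rfl

lemma setLIntegral_rpow {p l u : ℝ} (hl : 0 ≤ l) (hlu : l ≤ u)
    (hp : -1 < p ∨ p ≠ -1 ∧ 0 < l) :
    ∫⁻ y in Set.Ioc l u, ENNReal.ofReal (y ^ p) =
      ENNReal.ofReal ((u ^ (p + 1) - l ^ (p + 1)) / (p + 1)) := by
  have hnot : 0 < l → (0 : ℝ) ∉ Set.uIcc l u := by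
    intro h0 h
    rw [Set.uIcc_of_le hlu] at h
    linarith [h.1]
  have hint : IntervalIntegrable (fun y : ℝ => y ^ p) volume l u := by
    rcases hp with hp | hp
    · exact intervalIntegral.intervalIntegrable_rpow' hp
    · exact intervalIntegral.intervalIntegrable_rpow (Or.inr (hnot hp.2))
  rw [← integral_rpow (hp.imp id fun h => ⟨h.1, hnot h.2⟩), intervalIntegral.integral_of_le hlu,
    ofReal_integral_eq_lintegral_ofReal ((intervalIntegrable_iff_integrableOn_Ioc_of_le hlu).1 hint)]
  refine (ae_restrict_iff' measurableSet_Ioc).2 (Eventually.of_forall fun y hy => ?_)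
  exact Real.rpow_nonneg (hl.trans hy.1.le) _

lemma setLIntegral_inv {l u : ℝ} (hl : 0 < l) (hlu : l ≤ u) :
    ∫⁻ y in Set.Ioc l u, ENNReal.ofReal y⁻¹ = ENNReal.ofReal (Real.log (u / l)) := by
  have hint : IntervalIntegrable (fun y : ℝ => y⁻¹) volume l u := by
    refine intervalIntegral.intervalIntegrable_inv (fun y hy => ?_) continuousOn_id
    rw [Set.uIcc_of_le hlu] at hy
    exact (hl.trans_le hy.1).ne'
  rw [← integral_inv_of_pos hl (hl.trans_le hlu), intervalIntegral.integral_of_le hlu,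
    ofReal_integral_eq_lintegral_ofReal ((intervalIntegrable_iff_integrableOn_Ioc_of_le hlu).1 hint)]
  refine (ae_restrict_iff' measurableSet_Ioc).2 (Eventually.of_forall fun y hy => ?_)
  exact inv_nonneg.2 (hl.trans hy.1).le

/-- A pointwise bound by `c φ` on a superset gives an integral bound. -/
lemma setLIntegral_ofReal_le_of_le {S T : Set ℝ} {g φ : ℝ → ℝ} {c K : ℝ}
    (hST : S ⊆ T) (hc : 0 ≤ c) (hg : ∀ x ∈ S, g x ≤ c * φ x) (hS : MeasurableSet S)
    (hφ : ∫⁻ x in T, ENNReal.ofReal (φ x) ≤ ENNReal.ofReal K) :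
    ∫⁻ x in S, ENNReal.ofReal (g x) ≤ ENNReal.ofReal (c * K) := by
  calc ∫⁻ x in S, ENNReal.ofReal (g x)
      ≤ ∫⁻ x in S, ENNReal.ofReal c * ENNReal.ofReal (φ x) := by
        refine setLIntegral_mono' hS fun x hx => ?_
        rw [← ENNReal.ofReal_mul hc]
        exact ENNReal.ofReal_le_ofReal (hg x hx)
    _ = ENNReal.ofReal c * ∫⁻ x in S, ENNReal.ofReal (φ x) :=
        lintegral_const_mul' _ _ ENNReal.ofReal_ne_top
    _ ≤ ENNReal.ofReal c * ENNReal.ofReal K :=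
        mul_le_mul_right ((lintegral_mono_set hST).trans hφ) _
    _ = ENNReal.ofReal (c * K) := (ENNReal.ofReal_mul hc).symm

/-! ### Pointwise bounds for weighted polynomials -/

lemma rpow_le_two_rpow_abs {z : ℝ} (hz : z ∈ Set.Icc (1 / 2 : ℝ) 2) (p : ℝ) :
    z ^ p ≤ 2 ^ |p| := by
  have hz0 : 0 < z := by linarith [hz.1]
  rcases le_total 0 p with hp | hp
  · rw [abs_of_nonneg hp]
    exact Real.rpow_le_rpow hz0.le hz.2 hp
  · rw [abs_of_nonpos hp]
    calc z ^ p ≤ (1 / 2 : ℝ) ^ p := Real.rpow_le_rpow_of_nonpos (by norm_num) hz.1 hp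
      _ = 2 ^ (-p) := by rw [one_div, Real.inv_rpow (by norm_num), Real.rpow_neg (by norm_num)]

lemma rpow_le_two_rpow_abs_mul {s y : ℝ} (hs : 0 < s) (hy : y ∈ Set.Icc (s / 2) (2 * s)) (p : ℝ) :
    y ^ p ≤ 2 ^ |p| * s ^ p := by
  have hz : y / s ∈ Set.Icc (1 / 2 : ℝ) 2 :=
    ⟨by rw [le_div_iff₀ hs]; linarith [hy.1], by rw [div_le_iff₀ hs]; exact hy.2⟩
  have h := rpow_le_two_rpow_abs hz p
  have hy0 : 0 ≤ y := by linarith [hy.1]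
  rwa [Real.div_rpow hy0 hs.le, div_le_iff₀ (Real.rpow_pos_of_pos hs p)] at h

lemma max_zero_sub_max_zero_neg (c : ℝ) : max 0 c - max 0 (-c) = c := by
  rcases le_total 0 c with h | h
  · rw [max_eq_right h, max_eq_left (by linarith)]; ring
  · rw [max_eq_left h, max_eq_right (by linarith)]; ring

lemma jacobiWeight_eq_uPlus_mul (a b : ℝ) {x : ℝ} (hx : x ∈ Set.Ioo (-1 : ℝ) 1) :
    jacobiWeight a b x =
      uPlus a b x * ((1 - x) ^ (-max 0 (-a)) * (1 + x) ^ (-max 0 (-b))) := by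
  have h1 : 0 < 1 - x := by linarith [hx.2]
  have h2 : 0 < 1 + x := by linarith [hx.1]
  unfold uPlus jacobiWeight
  rw [mul_mul_mul_comm, ← Real.rpow_add h1, ← Real.rpow_add h2, ← sub_eq_add_neg, ← sub_eq_add_neg,
    max_zero_sub_max_zero_neg, max_zero_sub_max_zero_neg]

lemma uPlus_pos (a b : ℝ) {x : ℝ} (hx : x ∈ Set.Ioo (-1 : ℝ) 1) : 0 < uPlus a b x :=
  jacobiWeight_pos _ _ hx

lemma max_zero_neg_mem {b : ℝ} (hb : -1 < b) : 0 ≤ max 0 (-b) ∧ max 0 (-b) < 1 :=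
  ⟨le_max_left _ _, max_lt one_pos (by linarith)⟩

section Pointwise

variable {a b A : ℝ} {f : ℝ → ℝ}

lemma abs_mul_jacobiWeight_le (hf : ∀ x ∈ Set.Ioo (-1 : ℝ) 1, |f x| * uPlus a b x ≤ A)
    {x : ℝ} (hx : x ∈ Set.Ioo (-1 : ℝ) 1) :
    |f x * jacobiWeight a b x| ≤ A * ((1 - x) ^ (-max 0 (-a)) * (1 + x) ^ (-max 0 (-b))) := by
  rw [abs_mul, abs_of_pos (jacobiWeight_pos a b hx), jacobiWeight_eq_uPlus_mul a b hx, ← mul_assoc]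
  exact mul_le_mul_of_nonneg_right (hf x hx) (mul_nonneg
    (Real.rpow_nonneg (by linarith [hx.2]) _) (Real.rpow_nonneg (by linarith [hx.1]) _))

lemma abs_mul_jacobiWeight_le_of_neg_half_le (hb : -1 < b) (hA : 0 ≤ A)
    (hf : ∀ x ∈ Set.Ioo (-1 : ℝ) 1, |f x| * uPlus a b x ≤ A)
    {x : ℝ} (hx : -1 / 2 ≤ x) (hx1 : x < 1) :
    |f x * jacobiWeight a b x| ≤ 2 * A * (1 - x) ^ (-max 0 (-a)) := by
  have hx' : x ∈ Set.Ioo (-1 : ℝ) 1 := ⟨by linarith, hx1⟩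
  have hm := max_zero_neg_mem hb
  have h2 : (1 + x) ^ (-max 0 (-b)) ≤ 2 := by
    refine (rpow_le_two_rpow_abs ⟨by linarith, by linarith⟩ _).trans ?_
    rw [abs_neg, abs_of_nonneg hm.1]
    calc (2 : ℝ) ^ max 0 (-b) ≤ 2 ^ (1 : ℝ) :=
          Real.rpow_le_rpow_of_exponent_le (by norm_num) hm.2.le
      _ = 2 := Real.rpow_one 2
  have h1 : 0 ≤ (1 - x) ^ (-max 0 (-a)) := Real.rpow_nonneg (by linarith) _
  calc _ ≤ A * ((1 - x) ^ (-max 0 (-a)) * (1 + x) ^ (-max 0 (-b))) := abs_mul_jacobiWeight_le hf hx'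
    _ ≤ A * ((1 - x) ^ (-max 0 (-a)) * 2) := by gcongr
    _ = 2 * A * (1 - x) ^ (-max 0 (-a)) := by ring

lemma abs_mul_jacobiWeight_le_of_nonpos (hA : 0 ≤ A)
    (hf : ∀ x ∈ Set.Ioo (-1 : ℝ) 1, |f x| * uPlus a b x ≤ A)
    {x : ℝ} (hx : -1 < x) (hx1 : x ≤ 0) :
    |f x * jacobiWeight a b x| ≤ A * (1 + x) ^ (-max 0 (-b)) := by
  have hx' : x ∈ Set.Ioo (-1 : ℝ) 1 := ⟨hx, by linarith⟩
  have h2 : (1 - x) ^ (-max 0 (-a)) ≤ 1 :=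
    Real.rpow_le_one_of_one_le_of_nonpos (by linarith) (neg_nonpos.2 (le_max_left _ _))
  have h1 : 0 ≤ (1 + x) ^ (-max 0 (-b)) := Real.rpow_nonneg (by linarith) _
  calc _ ≤ A * ((1 - x) ^ (-max 0 (-a)) * (1 + x) ^ (-max 0 (-b))) := abs_mul_jacobiWeight_le hf hx'
    _ ≤ A * (1 * (1 + x) ^ (-max 0 (-b))) := by gcongr
    _ = A * (1 + x) ^ (-max 0 (-b)) := by ring

/-- Near an endpoint at which the weight vanishes, a weighted polynomial `P u` of degree `N` decays
like `(N² (1 - x)) ^ a`, because `P` is controlled up to the endpoint by its values at distance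
`≥ 1 / (16 N²)` from it. -/
lemma abs_eval_mul_jacobiWeight_le_of_pos {N : ℕ} {P : ℝ[X]} (hN : 1 ≤ N) (hP : P.natDegree ≤ N)
    (ha : 0 < a) (hb : -1 < b) (hA : 0 < A)
    (hf : ∀ x ∈ Set.Ioo (-1 : ℝ) 1, |P.eval x| * uPlus a b x ≤ A)
    {x : ℝ} (hx : -1 / 2 ≤ x) (hx1 : x < 1) :
    |P.eval x * jacobiWeight a b x| ≤
      2 * 2 ^ |b| * 16 ^ a * (N : ℝ) ^ (2 * a) * A * (1 - x) ^ a := by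
  have hN1 : (1 : ℝ) ≤ N := by exact_mod_cast hN
  have hN0 : (0 : ℝ) < N := by linarith
  have ham : max 0 (-a) = 0 := max_eq_left (by linarith)
  have hap : max 0 a = a := max_eq_right ha.le
  have hx' : x ∈ Set.Ioo (-1 : ℝ) 1 := ⟨by linarith, hx1⟩
  have h2b : (1 : ℝ) ≤ 2 ^ |b| := Real.one_le_rpow (by norm_num) (abs_nonneg b)
  have h16 : (1 : ℝ) ≤ 16 ^ a := Real.one_le_rpow (by norm_num) ha.le
  have hNa : (1 : ℝ) ≤ (N : ℝ) ^ (2 * a) := Real.one_le_rpow hN1 (by linarith)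
  rcases le_total x 0 with hx0 | hx0
  · have h1 := abs_mul_jacobiWeight_le_of_neg_half_le hb hA.le hf hx hx1
    rw [ham, neg_zero, Real.rpow_zero, mul_one] at h1
    have h3 : (1 : ℝ) ≤ (1 - x) ^ a := Real.one_le_rpow (by linarith) ha.le
    calc _ ≤ 2 * A := h1
      _ = 2 * 1 * 1 * 1 * A * 1 := by ring
      _ ≤ _ := by gcongr
  · set h : ℝ := 1 / (16 * (N : ℝ) ^ 2) with hh
    have hh0 : 0 < h := by positivity
    have hhN : 8 * (N : ℝ) ^ 2 * h = 1 / 2 := by rw [hh]; field_simp; norm_num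
    have hh1 : h ≤ 1 / 2 := by
      have : (1 : ℝ) ≤ N ^ 2 := one_le_pow₀ hN1
      nlinarith
    have hha : h ^ (-a) = 16 ^ a * (N : ℝ) ^ (2 * a) := by
      rw [hh, one_div, Real.inv_rpow (by positivity), Real.rpow_neg (by positivity), inv_inv,
        Real.mul_rpow (by norm_num) (by positivity), Real.rpow_mul hN0.le]
      norm_num
    have hbd : ∀ z ∈ Set.Icc (0 : ℝ) (1 - h), |P.eval z| ≤ A * h ^ (-a) := by
      intro z hz
      have hz' : z ∈ Set.Ioo (-1 : ℝ) 1 := ⟨by linarith [hz.1], by linarith [hz.2]⟩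
      have hlow : h ^ a ≤ uPlus a b z := by
        unfold uPlus jacobiWeight
        rw [hap]
        calc h ^ a = h ^ a * 1 := (mul_one _).symm
          _ ≤ (1 - z) ^ a * (1 + z) ^ max 0 b := by
            refine mul_le_mul (Real.rpow_le_rpow hh0.le (by linarith [hz.2]) ha.le)
              (Real.one_le_rpow (by linarith [hz.1]) (le_max_left _ _)) zero_le_one
              (Real.rpow_nonneg (by linarith [hz'.2]) _)
      rw [Real.rpow_neg hh0.le, ← div_eq_mul_inv, le_div_iff₀ (Real.rpow_pos_of_pos hh0 a)]
      exact (mul_le_mul_of_nonneg_left hlow (abs_nonneg _)).trans (hf z hz')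
    have hext := abs_eval_le_of_extend (d := 1 - h) (h := h) (c := 0) hP (by linarith) hh0.le
      (by linarith) (mul_pos hA (Real.rpow_pos_of_pos hh0 (-a))) hbd (x := x)
      ⟨hx0, by linarith⟩
    rw [abs_mul, abs_of_pos (jacobiWeight_pos a b hx'), jacobiWeight]
    have h4 : (1 + x) ^ b ≤ 2 ^ |b| := rpow_le_two_rpow_abs ⟨by linarith, by linarith⟩ b
    have h5 : 0 ≤ (1 - x) ^ a := Real.rpow_nonneg (by linarith) _
    have h6 : 0 ≤ h ^ (-a) := Real.rpow_nonneg hh0.le _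
    calc |P.eval x| * ((1 - x) ^ a * (1 + x) ^ b)
        ≤ 2 * (A * h ^ (-a)) * ((1 - x) ^ a * 2 ^ |b|) := by gcongr
      _ = _ := by rw [hha]; ring

/-- Lipschitz bound for a weighted polynomial at distances up to `s / 2` from `t`, where `s = 1 - t`,
from Markov's inequality on `[t - s/2, t + s/2]`. -/
lemma exists_lipschitz_eval_mul_jacobiWeight (a b : ℝ) : ∃ C : ℝ, 0 < C ∧
    ∀ (N : ℕ) (P : ℝ[X]) (A t : ℝ), 1 ≤ N → P.natDegree ≤ N → 0 < A →
      (∀ x ∈ Set.Ioo (-1 : ℝ) 1, |P.eval x| * uPlus a b x ≤ A) → 0 ≤ t → t < 1 →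
      ∀ x, |x - t| ≤ (1 - t) / 2 →
        |P.eval x * jacobiWeight a b x - P.eval t * jacobiWeight a b t| ≤
          C * A * N ^ 2 * (1 - t) ^ (-max 0 (-a) - 1) * |x - t| := by
  refine ⟨2 ^ (max 0 a + max 0 b) * (2 ^ |a| * 2 ^ |b|) * (4 + 2 * (|a| + |b|)), by positivity, ?_⟩
  intro N P A t hN hP hA hf ht0 ht1 x hx
  set s := 1 - t with hs
  have hs0 : 0 < s := by linarith
  have hN1 : (1 : ℝ) ≤ N := by exact_mod_cast hN
  set ap := max 0 a with hap
  set bp := max 0 b with hbp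
  have hap0 : 0 ≤ ap := le_max_left _ _
  have hbp0 : 0 ≤ bp := le_max_left _ _
  set J := Set.Icc (t - s / 2) (t + s / 2) with hJ
  have hJy : ∀ z ∈ J, 1 - z ∈ Set.Icc (s / 2) (2 * s) ∧ 1 + z ∈ Set.Icc (1 / 2 : ℝ) 2 ∧
      z ∈ Set.Ioo (-1 : ℝ) 1 := by
    intro z hz
    have h1 := hz.1
    have h2 := hz.2
    refine ⟨⟨?_, ?_⟩, ⟨?_, ?_⟩, ?_, ?_⟩ <;> linarith
  set M := 2 ^ (ap + bp) * A * s ^ (-ap) with hM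
  have hM0 : 0 < M := by positivity
  have hbd : ∀ z ∈ J, |P.eval z| ≤ M := by
    intro z hz
    obtain ⟨hy, hy2, hz'⟩ := hJy z hz
    have hlow : 2 ^ (-(ap + bp)) * s ^ ap ≤ uPlus a b z := by
      unfold uPlus jacobiWeight
      calc (2 : ℝ) ^ (-(ap + bp)) * s ^ ap = (s / 2) ^ ap * (1 / 2) ^ bp := by
            rw [neg_add, Real.rpow_add (by norm_num), Real.div_rpow hs0.le (by norm_num),
              Real.div_rpow (by norm_num) (by norm_num), Real.one_rpow,
              Real.rpow_neg (by norm_num), Real.rpow_neg (by norm_num)]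
            ring
        _ ≤ (1 - z) ^ ap * (1 + z) ^ bp :=
            mul_le_mul (Real.rpow_le_rpow (by positivity) hy.1 hap0)
              (Real.rpow_le_rpow (by norm_num) hy2.1 hbp0) (by positivity)
              (Real.rpow_nonneg (by linarith [hz'.2]) _)
    have h1 := (mul_le_mul_of_nonneg_left hlow (abs_nonneg (P.eval z))).trans (hf z hz')
    rw [Real.rpow_neg (by norm_num), ← div_eq_inv_mul, ← mul_div_assoc,
      div_le_iff₀ (by positivity)] at h1
    rw [hM, Real.rpow_neg hs0.le, ← div_eq_mul_inv, le_div_iff₀ (by positivity)]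
    linarith
  have hder : ∀ z ∈ J, HasDerivWithinAt (fun x => P.eval x * jacobiWeight a b x)
      (P.derivative.eval z * jacobiWeight a b z +
        P.eval z * (jacobiWeight a b z * (b / (1 + z) - a / (1 - z)))) J z := by
    intro z hz
    obtain ⟨hy, hy2, hz'⟩ := hJy z hz
    have h1 : (1 - z) ≠ 0 := by linarith [hz'.2]
    have h2 : (1 + z) ≠ 0 := by linarith [hz'.1]
    have hd1 : HasDerivAt (fun x : ℝ => (1 - x) ^ a) (-1 * a * (1 - z) ^ (a - 1)) z :=
      ((hasDerivAt_id z).const_sub 1).rpow_const (Or.inl h1)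
    have hd2 : HasDerivAt (fun x : ℝ => (1 + x) ^ b) (1 * b * (1 + z) ^ (b - 1)) z :=
      ((hasDerivAt_id z).const_add 1).rpow_const (Or.inl h2)
    refine HasDerivAt.hasDerivWithinAt ?_
    refine ((P.hasDerivAt z).mul (hd1.mul hd2)).congr_deriv ?_
    rw [Real.rpow_sub_one h1, Real.rpow_sub_one h2, jacobiWeight]
    simp only [Pi.mul_apply]
    field_simp
    ring
  have hbound : ∀ z ∈ J, ‖P.derivative.eval z * jacobiWeight a b z +
        P.eval z * (jacobiWeight a b z * (b / (1 + z) - a / (1 - z)))‖ ≤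
      2 ^ (ap + bp) * (2 ^ |a| * 2 ^ |b|) * (4 + 2 * (|a| + |b|)) * A * N ^ 2 *
        s ^ (-max 0 (-a) - 1) := by
    intro z hz
    obtain ⟨hy, hy2, hz'⟩ := hJy z hz
    have hy0 : 0 < 1 - z := by linarith [hz'.2]
    have hy20 : 0 < 1 + z := by linarith [hz'.1]
    have hw : jacobiWeight a b z ≤ 2 ^ |a| * s ^ a * 2 ^ |b| :=
      mul_le_mul (rpow_le_two_rpow_abs_mul hs0 hy a) (rpow_le_two_rpow_abs hy2 b)
        (Real.rpow_nonneg hy20.le _) (by positivity)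
    have hw0 := jacobiWeight_pos a b hz'
    have hPd : |P.derivative.eval z| ≤ 4 * N ^ 2 / s * M := by
      have h := abs_derivative_eval_le hP (by linarith : t - s / 2 < t + s / 2) hM0 hbd hz
      have : t + s / 2 - (t - s / 2) = s := by ring
      rwa [this] at h
    have hlog : |b / (1 + z) - a / (1 - z)| ≤ 2 * (|a| + |b|) / s := by
      have h1 : |b / (1 + z)| ≤ 2 * |b| / s := by
        rw [abs_div, abs_of_pos hy20, div_le_div_iff₀ hy20 hs0]
        have : s ≤ 2 * (1 + z) := by linarith [hy2.1]
        nlinarith [abs_nonneg b]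
      have h2 : |a / (1 - z)| ≤ 2 * |a| / s := by
        rw [abs_div, abs_of_pos hy0, div_le_div_iff₀ hy0 hs0]
        have : s ≤ 2 * (1 - z) := by linarith [hy.1]
        nlinarith [abs_nonneg a]
      calc _ ≤ |b / (1 + z)| + |a / (1 - z)| := abs_sub _ _
        _ ≤ 2 * |b| / s + 2 * |a| / s := add_le_add h1 h2
        _ = _ := by ring
    have hsa : s ^ (-ap) * s ^ a / s = s ^ (-max 0 (-a) - 1) := by
      rw [← Real.rpow_add hs0, Real.rpow_sub_one hs0.ne']
      congr 2
      have := max_zero_sub_max_zero_neg a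
      rw [← hap] at this
      linarith
    rw [Real.norm_eq_abs]
    calc _ ≤ |P.derivative.eval z| * jacobiWeight a b z +
          |P.eval z| * (jacobiWeight a b z * |b / (1 + z) - a / (1 - z)|) := by
          refine (abs_add_le _ _).trans (le_of_eq ?_)
          rw [abs_mul, abs_mul, abs_mul, abs_of_pos hw0]
      _ ≤ 4 * N ^ 2 / s * M * (2 ^ |a| * s ^ a * 2 ^ |b|) +
          M * ((2 ^ |a| * s ^ a * 2 ^ |b|) * (2 * (|a| + |b|) / s)) := by
          have := hbd z hz
          gcongr
      _ = 2 ^ (ap + bp) * (2 ^ |a| * 2 ^ |b|) * (4 * N ^ 2 + 2 * (|a| + |b|)) * A *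
          (s ^ (-ap) * s ^ a / s) := by rw [hM]; ring
      _ ≤ 2 ^ (ap + bp) * (2 ^ |a| * 2 ^ |b|) * ((4 + 2 * (|a| + |b|)) * N ^ 2) * A *
          (s ^ (-ap) * s ^ a / s) := by
          have h1 : (1 : ℝ) ≤ N ^ 2 := one_le_pow₀ hN1
          have h2 : 0 ≤ 2 * (|a| + |b|) := by positivity
          have h3 : 4 * (N : ℝ) ^ 2 + 2 * (|a| + |b|) ≤ (4 + 2 * (|a| + |b|)) * N ^ 2 := by
            nlinarith
          gcongr
      _ = _ := by rw [hsa]; ring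
  have hxJ : x ∈ J := by
    rw [abs_le] at hx
    exact ⟨by linarith [hx.1], by linarith [hx.2]⟩
  have htJ : t ∈ J := ⟨by linarith, by linarith⟩
  exact (convex_Icc _ _).norm_image_sub_le_of_norm_hasDerivWithin_le hder hbound htJ hxJ

end Pointwise

/-! ### The weight of the error bound -/

lemma jacobiWeight_nonneg (γ δ : ℝ) {x : ℝ} (hx : x ∈ Set.Icc (-1 : ℝ) 1) :
    0 ≤ jacobiWeight γ δ x :=
  mul_nonneg (Real.rpow_nonneg (by linarith [hx.2]) _) (Real.rpow_nonneg (by linarith [hx.1]) _)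

lemma one_le_uTwo_denominator (a b x : ℝ) :
    1 ≤ 1 + uPlus a b (-1) * uMinus a b (-1) * |Real.log (1 + x)|
      + uPlus a b 1 * uMinus a b 1 * |Real.log (1 - x)| := by
  have h1 : ∀ γ δ : ℝ, 0 ≤ jacobiWeight γ δ (-1) := fun γ δ =>
    jacobiWeight_nonneg γ δ ⟨le_rfl, by norm_num⟩
  have h2 : ∀ γ δ : ℝ, 0 ≤ jacobiWeight γ δ 1 := fun γ δ =>
    jacobiWeight_nonneg γ δ ⟨by norm_num, le_rfl⟩
  have h3 := mul_nonneg (mul_nonneg (h1 (max 0 a) (max 0 b)) (h1 (max 0 (-a)) (max 0 (-b))))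
    (abs_nonneg (Real.log (1 + x)))
  have h4 := mul_nonneg (mul_nonneg (h2 (max 0 a) (max 0 b)) (h2 (max 0 (-a)) (max 0 (-b))))
    (abs_nonneg (Real.log (1 - x)))
  unfold uPlus uMinus
  linarith

lemma uTwo_nonneg (a b : ℝ) {x : ℝ} (hx : x ∈ Set.Ioo (-1 : ℝ) 1) : 0 ≤ uTwo a b x :=
  div_nonneg (jacobiWeight_pos _ _ hx).le (zero_le_one.trans (one_le_uTwo_denominator a b x))

lemma uMinus_le {a b t : ℝ} (hb : -1 < b) (ht0 : 0 ≤ t) (ht1 : t < 1) :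
    uMinus a b t ≤ 2 * (1 - t) ^ max 0 (-a) := by
  have hm := max_zero_neg_mem hb
  have h2 : (1 + t) ^ max 0 (-b) ≤ 2 := by
    calc (1 + t) ^ max 0 (-b) ≤ 2 ^ max 0 (-b) :=
          Real.rpow_le_rpow (by linarith) (by linarith) hm.1
      _ ≤ 2 ^ (1 : ℝ) := Real.rpow_le_rpow_of_exponent_le (by norm_num) hm.2.le
      _ = 2 := Real.rpow_one 2
  have h1 : 0 ≤ (1 - t) ^ max 0 (-a) := Real.rpow_nonneg (by linarith) _
  unfold uMinus jacobiWeight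
  rw [mul_comm 2]
  exact mul_le_mul_of_nonneg_left h2 h1

lemma uTwo_le {a b t : ℝ} (hb : -1 < b) (ht0 : 0 ≤ t) (ht1 : t < 1) :
    uTwo a b t ≤ 2 * (1 - t) ^ max 0 (-a) :=
  (div_le_self (jacobiWeight_pos _ _ ⟨by linarith, ht1⟩).le
    (one_le_uTwo_denominator a b t)).trans (uMinus_le hb ht0 ht1)

lemma abs_log_mul_uTwo_zero_le {b t : ℝ} (hb : -1 < b) (ht0 : 0 ≤ t) (ht1 : t < 1) :
    |Real.log (1 - t)| * uTwo 0 b t ≤ 2 := by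
  have hu := uMinus_le (a := 0) hb ht0 ht1
  simp only [neg_zero, max_self, Real.rpow_zero, mul_one] at hu
  have hD := one_le_uTwo_denominator 0 b t
  have hu0 : 0 ≤ uMinus 0 b t := (jacobiWeight_pos _ _ ⟨by linarith, ht1⟩).le
  rw [uTwo, ← mul_div_assoc, div_le_iff₀ (by linarith)]
  have h1 : 1 ≤ uPlus 0 b 1 * uMinus 0 b 1 := by
    have : ∀ q : ℝ, 0 ≤ q → 1 ≤ jacobiWeight (max 0 0) q 1 := by
      intro q hq
      simp only [jacobiWeight, max_self, Real.rpow_zero, one_mul]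
      exact Real.one_le_rpow (by norm_num) hq
    have h3 := this (max 0 b) (le_max_left _ _)
    have h4 := this (max 0 (-b)) (le_max_left _ _)
    unfold uPlus uMinus
    rw [neg_zero]
    nlinarith
  have h2 : 0 ≤ uPlus 0 b (-1) * uMinus 0 b (-1) * |Real.log (1 + t)| :=
    mul_nonneg (mul_nonneg (jacobiWeight_nonneg _ _ ⟨le_rfl, by norm_num⟩)
      (jacobiWeight_nonneg _ _ ⟨le_rfl, by norm_num⟩)) (abs_nonneg _)
  have h3 := mul_le_mul_of_nonneg_right h1 (abs_nonneg (Real.log (1 - t)))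
  have h4 := mul_le_mul_of_nonneg_left hu (abs_nonneg (Real.log (1 - t)))
  linarith

/-! ### The integral of the regularized kernel of a weighted polynomial -/

lemma half_le_log {N : ℕ} (hN : 2 ≤ N) : 1 / 2 ≤ Real.log N := by
  have h1 : Real.log 2 ≤ Real.log N := Real.log_le_log (by norm_num) (by exact_mod_cast hN)
  linarith [Real.log_two_gt_d9]

lemma log_two_mul_sq_le {N : ℕ} (hN : 2 ≤ N) : Real.log (2 * (N : ℝ) ^ 2) ≤ 3 * Real.log N := by
  have hN0 : (0 : ℝ) < N := by exact_mod_cast (by omega : 0 < N)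
  have h1 : Real.log 2 ≤ Real.log N := Real.log_le_log (by norm_num) (by exact_mod_cast hN)
  rw [Real.log_mul (by norm_num) (by positivity), Real.log_pow]
  push_cast
  linarith

lemma abs_regularizedKernel_of_le {F : ℝ → ℝ} {t δ x : ℝ} (h : δ ≤ |x - t|) :
    |regularizedKernel F t δ x| = |F x| / |x - t| := by
  rw [regularizedKernel, if_neg (not_lt.2 h), sub_zero, abs_div]

/-- Contribution of `(-1, -1/2]`, where the kernel is bounded and `u` may be singular at `-1`. -/
lemma lintegral_regularizedKernel_far {a b A t δ : ℝ} {f : ℝ → ℝ} (hb : -1 < b) (hA : 0 ≤ A)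
    (hf : ∀ x ∈ Set.Ioo (-1 : ℝ) 1, |f x| * uPlus a b x ≤ A) (ht0 : 0 ≤ t)
    (hδ : δ ≤ 1 / 2) :
    ∫⁻ x in Set.Ioc (-1 : ℝ) (-1 / 2), ENNReal.ofReal
        |regularizedKernel (fun x => f x * jacobiWeight a b x) t δ x| ≤
      ENNReal.ofReal (2 * A * (1 / (1 - max 0 (-b)))) := by
  have hm := max_zero_neg_mem hb
  refine setLIntegral_ofReal_le_of_le (T := {x | x - (-1) ∈ Set.Ioc (0 : ℝ) 1})
    (φ := fun x => (x - (-1)) ^ (-max 0 (-b))) ?_ (by positivity) ?_ measurableSet_Ioc ?_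
  · intro x hx
    exact ⟨by linarith [hx.1], by linarith [hx.2]⟩
  · intro x hx
    have hd : 1 / 2 ≤ |x - t| := by
      rw [abs_of_neg (by linarith [hx.2])]; linarith [hx.2]
    rw [abs_regularizedKernel_of_le (hδ.trans hd)]
    have h1 := abs_mul_jacobiWeight_le_of_nonpos hA hf hx.1 (by linarith [hx.2])
    have h2 : x - (-1) = 1 + x := by ring
    rw [h2, div_le_iff₀ (by linarith)]
    refine h1.trans ?_
    have h3 : 0 ≤ A * (1 + x) ^ (-max 0 (-b)) :=
      mul_nonneg hA (Real.rpow_nonneg (by linarith [hx.1]) _)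
    nlinarith
  · rw [setLIntegral_comp_sub_right (fun y => ENNReal.ofReal (y ^ (-max 0 (-b)))) (-1)
      measurableSet_Ioc, setLIntegral_rpow le_rfl zero_le_one (Or.inl (by linarith [hm.2]))]
    rw [Real.one_rpow, Real.zero_rpow (by linarith [hm.2]), sub_zero, neg_add_eq_sub]

/-- Contribution of the points between `t` and `1`, not closer to `t` than to `1`. -/
lemma lintegral_regularizedKernel_endpoint {a b A t δ : ℝ} {f : ℝ → ℝ} (ha : -1 < a) (hb : -1 < b)
    (hA : 0 ≤ A) (hf : ∀ x ∈ Set.Ioo (-1 : ℝ) 1, |f x| * uPlus a b x ≤ A) (ht0 : 0 ≤ t)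
    (ht1 : t < 1) (hδ : δ ≤ (1 - t) / 2) :
    ∫⁻ x in Set.Ico (t + (1 - t) / 2) 1, ENNReal.ofReal
        |regularizedKernel (fun x => f x * jacobiWeight a b x) t δ x| ≤
      ENNReal.ofReal (4 / (1 - max 0 (-a)) * (A * (1 - t) ^ (-max 0 (-a)))) := by
  have hm := max_zero_neg_mem ha
  set s := 1 - t with hs
  have hs0 : 0 < s := by linarith
  have hK : 4 * A / s * (s ^ (-max 0 (-a) + 1) / (-max 0 (-a) + 1)) =
      4 / (1 - max 0 (-a)) * (A * s ^ (-max 0 (-a))) := by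
    rw [Real.rpow_add_one hs0.ne', neg_add_eq_sub]
    field_simp
  rw [← hK]
  refine setLIntegral_ofReal_le_of_le (T := {x | 1 - x ∈ Set.Ioc (0 : ℝ) s})
    (φ := fun x => (1 - x) ^ (-max 0 (-a))) ?_ (by positivity) ?_ measurableSet_Ico ?_
  · intro x hx
    exact ⟨by linarith [hx.2], by linarith [hx.1]⟩
  · intro x hx
    have hd : s / 2 ≤ |x - t| := by
      rw [abs_of_pos (by linarith [hx.1])]; linarith [hx.1]
    rw [abs_regularizedKernel_of_le (hδ.trans hd)]
    have h1 := abs_mul_jacobiWeight_le_of_neg_half_le hb hA hf (by linarith [hx.1]) hx.2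
    have h3 : 0 ≤ (1 - x) ^ (-max 0 (-a)) := Real.rpow_nonneg (by linarith [hx.2]) _
    rw [div_le_iff₀ (by linarith)]
    refine h1.trans ?_
    calc 2 * A * (1 - x) ^ (-max 0 (-a))
        = 4 * A / s * (1 - x) ^ (-max 0 (-a)) * (s / 2) := by field_simp; ring
      _ ≤ _ := by gcongr
  · rw [setLIntegral_comp_sub_left (fun y => ENNReal.ofReal (y ^ (-max 0 (-a)))) 1
      measurableSet_Ioc, setLIntegral_rpow le_rfl hs0.le (Or.inl (by linarith [hm.2])),
      Real.zero_rpow (by linarith [hm.2]), sub_zero]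

/-- Contribution of the points at distance between `δ` and `1 - t` from `t` whose distance to `1` is
comparable to `1 - t`. -/
lemma lintegral_regularizedKernel_intermediate {a b A t δ : ℝ} {f : ℝ → ℝ} (ha : -1 < a)
    (hb : -1 < b) (hA : 0 ≤ A) (hf : ∀ x ∈ Set.Ioo (-1 : ℝ) 1, |f x| * uPlus a b x ≤ A)
    (ht0 : 0 ≤ t) (ht1 : t < 1) (hδ0 : 0 < δ) (hδ : δ ≤ (1 - t) / 2) :
    ∫⁻ x in Set.Ico (t + δ) (t + (1 - t) / 2), ENNReal.ofReal
        |regularizedKernel (fun x => f x * jacobiWeight a b x) t δ x| ≤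
      ENNReal.ofReal (4 * A * (1 - t) ^ (-max 0 (-a)) * Real.log ((1 - t) / (δ / 2))) ∧
    ∫⁻ x in Set.Ioc (t - (1 - t)) (t - δ) ∩ Set.Ioi (-1 / 2), ENNReal.ofReal
        |regularizedKernel (fun x => f x * jacobiWeight a b x) t δ x| ≤
      ENNReal.ofReal (4 * A * (1 - t) ^ (-max 0 (-a)) * Real.log ((1 - t) / (δ / 2))) := by
  have hm := max_zero_neg_mem ha
  set s := 1 - t with hs
  have hs0 : 0 < s := by linarith
  have hsm : 0 ≤ s ^ (-max 0 (-a)) := Real.rpow_nonneg hs0.le _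
  have hF : ∀ x, -1 / 2 ≤ x → 1 - x ∈ Set.Icc (s / 2) (2 * s) →
      |f x * jacobiWeight a b x| ≤ 4 * A * s ^ (-max 0 (-a)) := by
    intro x hx hy
    have h1 := abs_mul_jacobiWeight_le_of_neg_half_le hb hA hf hx (by linarith [hy.1])
    have h2 := rpow_le_two_rpow_abs_mul hs0 hy (-max 0 (-a))
    have h3 : (2 : ℝ) ^ |-max 0 (-a)| ≤ 2 := by
      rw [abs_neg, abs_of_nonneg hm.1]
      calc (2 : ℝ) ^ max 0 (-a) ≤ 2 ^ (1 : ℝ) :=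
            Real.rpow_le_rpow_of_exponent_le (by norm_num) hm.2.le
        _ = 2 := Real.rpow_one 2
    calc _ ≤ 2 * A * (1 - x) ^ (-max 0 (-a)) := h1
      _ ≤ 2 * A * (2 * s ^ (-max 0 (-a))) := by
          refine mul_le_mul_of_nonneg_left (h2.trans ?_) (by positivity)
          exact mul_le_mul_of_nonneg_right h3 hsm
      _ = _ := by ring
  constructor
  · refine setLIntegral_ofReal_le_of_le (T := {x | x - t ∈ Set.Ioc (δ / 2) s})
      (φ := fun x => (x - t)⁻¹) ?_ (by positivity) ?_ measurableSet_Ico ?_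
    · intro x hx
      exact ⟨by linarith [hx.1], by linarith [hx.2]⟩
    · intro x hx
      have hd : |x - t| = x - t := abs_of_pos (by linarith [hx.1])
      rw [abs_regularizedKernel_of_le (by rw [hd]; linarith [hx.1]), hd, div_eq_mul_inv]
      refine mul_le_mul_of_nonneg_right (hF x (by linarith [hx.1]) ⟨?_, ?_⟩)
        (inv_nonneg.2 (by linarith [hx.1]))
      · linarith [hx.2]
      · linarith [hx.1]
    · rw [setLIntegral_comp_sub_right (fun y => ENNReal.ofReal y⁻¹) t measurableSet_Ioc,
        setLIntegral_inv (by positivity) (by linarith)]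
  · refine setLIntegral_ofReal_le_of_le (T := {x | t - x ∈ Set.Ioc (δ / 2) s})
      (φ := fun x => (t - x)⁻¹) ?_ (by positivity) ?_ (measurableSet_Ioc.inter measurableSet_Ioi) ?_
    · rintro x ⟨hx, -⟩
      exact ⟨by linarith [hx.2], by linarith [hx.1]⟩
    · rintro x ⟨hx, hx2⟩
      have hx2' : -1 / 2 < x := hx2
      have hd : |x - t| = t - x := by rw [abs_of_neg (by linarith [hx.2])]; ring
      rw [abs_regularizedKernel_of_le (by rw [hd]; linarith [hx.2]), hd, div_eq_mul_inv]
      refine mul_le_mul_of_nonneg_right (hF x hx2'.le ⟨?_, ?_⟩)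
        (inv_nonneg.2 (by linarith [hx.2]))
      · linarith [hx.2]
      · linarith [hx.1]
    · rw [setLIntegral_comp_sub_left (fun y => ENNReal.ofReal y⁻¹) t measurableSet_Ioc,
        setLIntegral_inv (by positivity) (by linarith)]

/-- Contribution of the neighbourhood of the singularity, for a Lipschitz function. -/
lemma lintegral_regularizedKernel_near {F : ℝ → ℝ} {t δ L : ℝ} (hL : 0 ≤ L)
    (hF : ∀ x, |x - t| < δ → |F x - F t| ≤ L * |x - t|) :
    ∫⁻ x in Set.Ioo (t - δ) (t + δ), ENNReal.ofReal |regularizedKernel F t δ x| ≤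
      ENNReal.ofReal (L * (2 * δ)) := by
  refine setLIntegral_ofReal_le_of_le (T := Set.Ioo (t - δ) (t + δ)) (φ := fun _ => 1)
    subset_rfl hL ?_ measurableSet_Ioo ?_
  · intro x hx
    have hd : |x - t| < δ := abs_sub_lt_iff.2 ⟨by linarith [hx.2], by linarith [hx.1]⟩
    rw [regularizedKernel, if_pos hd, abs_div, mul_one]
    exact div_le_of_le_mul₀ (abs_nonneg _) hL (hF x hd)
  · rw [ENNReal.ofReal_one, setLIntegral_one, Real.volume_Ioo]
    exact ENNReal.ofReal_le_ofReal (by linarith)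

/-- Contribution of the points `x < t` whose distance to `1` is at least `2 (1 - t)`. For `a < 0` the
singularity of `u` at `1` makes the integral of order `(1 - t) ^ a`; for `a = 0` it is of order
`|log (1 - t)|`, which the weight `u₂` absorbs; for `a > 0` the decay of `P u` at `1` leaves only
distances to `1` above `N⁻²`, hence a factor `log N`. -/
lemma exists_lintegral_regularizedKernel_left {a b : ℝ} (ha : -1 < a) (hb : -1 < b) :
    ∃ C : ℝ, 0 < C ∧ ∀ (N : ℕ) (P : ℝ[X]) (A t δ : ℝ), 2 ≤ N → P.natDegree ≤ N → 0 < A →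
      (∀ x ∈ Set.Ioo (-1 : ℝ) 1, |P.eval x| * uPlus a b x ≤ A) → 0 ≤ t → t < 1 → δ ≤ (1 - t) / 2 →
      ∃ K : ℝ, 0 ≤ K ∧ ∫⁻ x in Set.Ioc (-1 / 2) (t - (1 - t)), ENNReal.ofReal
          |regularizedKernel (fun x => P.eval x * jacobiWeight a b x) t δ x| ≤ ENNReal.ofReal K ∧
        K * uTwo a b t ≤ C * A * Real.log N := by
  have hm := max_zero_neg_mem ha
  have hker : ∀ (P : ℝ[X]) (t δ x : ℝ), t < 1 → δ ≤ (1 - t) / 2 →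
      x ∈ Set.Ioc (-1 / 2) (t - (1 - t)) →
      |regularizedKernel (fun x => P.eval x * jacobiWeight a b x) t δ x| ≤
        |P.eval x * jacobiWeight a b x| * (2 * (1 - x)⁻¹) := by
    intro P t δ x ht1 hδ hx
    have h0 : 0 < 1 - x := by linarith [hx.2]
    have hd : (1 - x) / 2 ≤ |x - t| := by
      rw [abs_of_neg (by linarith [hx.2])]; linarith [hx.2]
    rw [abs_regularizedKernel_of_le (by linarith [hx.2]), div_eq_mul_inv]
    refine mul_le_mul_of_nonneg_left ?_ (abs_nonneg _)
    calc |x - t|⁻¹ ≤ ((1 - x) / 2)⁻¹ := inv_anti₀ (by linarith) hd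
      _ = 2 * (1 - x)⁻¹ := by rw [inv_div, div_eq_mul_inv]
  rcases lt_trichotomy a 0 with ha0 | rfl | ha0
  · have ham : max 0 (-a) = -a := max_eq_right (by linarith)
    refine ⟨16 / (-a), by apply div_pos <;> linarith, ?_⟩
    intro N P A t δ hN hP hA hf ht0 ht1 hδ
    set s := 1 - t with hs
    have hs0 : 0 < s := by linarith
    have hsa : 0 < s ^ a := Real.rpow_pos_of_pos hs0 a
    have h2a : 0 < (2 : ℝ) ^ a := Real.rpow_pos_of_pos two_pos a
    refine ⟨4 * A * (s ^ a / (-a)), mul_nonneg (by positivity) (div_nonneg hsa.le (by linarith)),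
      ?_, ?_⟩
    · refine setLIntegral_ofReal_le_of_le (T := {x | 1 - x ∈ Set.Ioc s 2})
        (φ := fun x => (1 - x) ^ (a - 1)) ?_ (by positivity) ?_ measurableSet_Ioc ?_
      · intro x hx
        exact ⟨by linarith [hx.2], by linarith [hx.1]⟩
      · intro x hx
        have h0 : 0 < 1 - x := by linarith [hx.2]
        have h1 := abs_mul_jacobiWeight_le_of_neg_half_le hb hA.le hf hx.1.le (by linarith)
        rw [ham, neg_neg] at h1
        refine (hker P t δ x ht1 hδ hx).trans ?_
        rw [Real.rpow_sub_one h0.ne']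
        calc _ ≤ 2 * A * (1 - x) ^ a * (2 * (1 - x)⁻¹) := by gcongr
          _ = _ := by rw [div_eq_mul_inv]; ring
      · rw [setLIntegral_comp_sub_left (fun y => ENNReal.ofReal (y ^ (a - 1))) 1 measurableSet_Ioc,
          setLIntegral_rpow hs0.le (by linarith) (Or.inr ⟨by linarith, hs0⟩), sub_add_cancel]
        refine ENNReal.ofReal_le_ofReal ?_
        rw [← neg_div_neg_eq]
        exact div_le_div_of_nonneg_right (by linarith) (by linarith)
    · have hu := uTwo_le (a := a) hb ht0 ht1
      rw [ham, ← hs] at hu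
      have hcancel : s ^ a * s ^ (-a) = 1 := by
        rw [← Real.rpow_add hs0, add_neg_cancel, Real.rpow_zero]
      have hna : 0 < -a := by linarith
      calc _ ≤ 4 * A * (s ^ a / (-a)) * (2 * s ^ (-a)) := by gcongr
        _ = 8 / (-a) * A * (s ^ a * s ^ (-a)) := by ring
        _ = 16 / (-a) * A * (1 / 2) := by rw [hcancel]; ring
        _ ≤ _ := by
          have := half_le_log hN
          gcongr
  · refine ⟨32, by norm_num, ?_⟩
    intro N P A t δ hN hP hA hf ht0 ht1 hδ
    set s := 1 - t with hs
    have hs0 : 0 < s := by linarith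
    have hlog : Real.log (2 / s) = Real.log 2 + |Real.log s| := by
      rw [Real.log_div (by norm_num) hs0.ne', abs_of_nonpos (Real.log_nonpos hs0.le (by linarith))]
      ring
    refine ⟨4 * A * Real.log (2 / s), ?_, ?_, ?_⟩
    · rw [hlog]; positivity
    · refine setLIntegral_ofReal_le_of_le (T := {x | 1 - x ∈ Set.Ioc s 2})
        (φ := fun x => (1 - x)⁻¹) ?_ (by positivity) ?_ measurableSet_Ioc ?_
      · intro x hx
        exact ⟨by linarith [hx.2], by linarith [hx.1]⟩
      · intro x hx
        have h0 : 0 < 1 - x := by linarith [hx.2]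
        have h1 := abs_mul_jacobiWeight_le_of_neg_half_le hb hA.le hf hx.1.le (by linarith)
        rw [neg_zero, max_self, neg_zero, Real.rpow_zero, mul_one] at h1
        refine (hker P t δ x ht1 hδ hx).trans ?_
        calc _ ≤ 2 * A * (2 * (1 - x)⁻¹) := by gcongr
          _ = _ := by ring
      · rw [setLIntegral_comp_sub_left (fun y => ENNReal.ofReal y⁻¹) 1 measurableSet_Ioc,
          setLIntegral_inv hs0 (by linarith)]
    · have hu := uTwo_le (a := 0) hb ht0 ht1
      rw [neg_zero, max_self, Real.rpow_zero, mul_one] at hu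
      have hu2 := abs_log_mul_uTwo_zero_le hb ht0 ht1
      have hl2 : Real.log 2 ≤ 1 := by linarith [Real.log_two_lt_d9]
      have hl0 : 0 ≤ Real.log 2 := Real.log_nonneg (by norm_num)
      have h3 : Real.log 2 * uTwo 0 b t ≤ 1 * 2 :=
        mul_le_mul hl2 hu (uTwo_nonneg _ _ ⟨by linarith, ht1⟩) zero_le_one
      rw [hlog]
      calc _ = 4 * A * (Real.log 2 * uTwo 0 b t + |Real.log s| * uTwo 0 b t) := by ring
        _ ≤ 4 * A * (1 * 2 + 2) := by gcongr
        _ = 32 * A * (1 / 2) := by ring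
        _ ≤ _ := by
          have := half_le_log hN
          gcongr
  · have ham : max 0 (-a) = 0 := max_eq_left (by linarith)
    set B : ℝ := 2 * 2 ^ |b| * 16 ^ a with hB
    have hB0 : 0 < B := by positivity
    refine ⟨8 * B / a + 24, by positivity, ?_⟩
    intro N P A t δ hN hP hA hf ht0 ht1 hδ
    have hN0 : (0 : ℝ) < N := by exact_mod_cast (by omega : 0 < N)
    set s := 1 - t with hs
    have hs0 : 0 < s := by linarith
    set h : ℝ := ((N : ℝ) ^ 2)⁻¹ with hh
    have hh0 : 0 < h := by positivity
    have hh2 : h ≤ 2 := by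
      have : (1 : ℝ) ≤ (N : ℝ) ^ 2 := one_le_pow₀ (by exact_mod_cast (by omega : 1 ≤ N))
      exact (inv_le_one_of_one_le₀ this).trans (by norm_num)
    have hha : (N : ℝ) ^ (2 * a) * h ^ a = 1 := by
      rw [Real.rpow_mul hN0.le, ← Real.mul_rpow (by positivity) hh0.le, hh]
      norm_num
      rw [mul_inv_cancel₀ (by positivity), Real.one_rpow]
    have hlogN := half_le_log hN
    have hlog2 : Real.log (2 / h) ≤ 3 * Real.log N := by
      rw [hh, div_inv_eq_mul]; exact log_two_mul_sq_le hN
    set S := Set.Ioc (-1 / 2) (t - s) with hS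
    refine ⟨2 * B * (N : ℝ) ^ (2 * a) * A * (h ^ a / a) + 4 * A * (3 * Real.log N), by positivity,
      ?_, ?_⟩
    · have hsplit : S ⊆ (S ∩ Set.Ici (1 - h)) ∪ (S ∩ Set.Iio (1 - h)) := by
        intro x hx
        rcases le_or_gt (1 - h) x with h' | h'
        · exact Or.inl ⟨hx, h'⟩
        · exact Or.inr ⟨hx, h'⟩
      refine (lintegral_mono_set hsplit).trans ((lintegral_union_le _ _ _).trans ?_)
      rw [ENNReal.ofReal_add (by positivity) (by positivity)]
      refine add_le_add ?_ ?_
      · refine setLIntegral_ofReal_le_of_le (T := {x | 1 - x ∈ Set.Ioc 0 h})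
          (φ := fun x => (1 - x) ^ (a - 1)) ?_ (by positivity) ?_
          (measurableSet_Ioc.inter measurableSet_Ici) ?_
        · rintro x ⟨hx, hx2⟩
          have hx2' : 1 - h ≤ x := hx2
          exact ⟨by linarith [hx.2], by linarith⟩
        · rintro x ⟨hx, -⟩
          have h0 : 0 < 1 - x := by linarith [hx.2]
          have h1 := abs_eval_mul_jacobiWeight_le_of_pos (by omega : 1 ≤ N) hP ha0 hb hA hf
            hx.1.le (by linarith)
          refine (hker P t δ x ht1 hδ hx).trans ?_
          rw [Real.rpow_sub_one h0.ne']
          calc _ ≤ 2 * 2 ^ |b| * 16 ^ a * (N : ℝ) ^ (2 * a) * A * (1 - x) ^ a *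
                (2 * (1 - x)⁻¹) := by gcongr
            _ = _ := by rw [div_eq_mul_inv, hB]; ring
        · rw [setLIntegral_comp_sub_left (fun y => ENNReal.ofReal (y ^ (a - 1))) 1
            measurableSet_Ioc, setLIntegral_rpow le_rfl hh0.le (Or.inl (by linarith)),
            sub_add_cancel, Real.zero_rpow ha0.ne', sub_zero]
      · refine setLIntegral_ofReal_le_of_le (T := {x | 1 - x ∈ Set.Ioc h 2})
          (φ := fun x => (1 - x)⁻¹) ?_ (by positivity) ?_
          (measurableSet_Ioc.inter measurableSet_Iio) ?_
        · rintro x ⟨hx, hx2⟩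
          have hx2' : x < 1 - h := hx2
          exact ⟨by linarith, by linarith [hx.1]⟩
        · rintro x ⟨hx, -⟩
          have h0 : 0 < 1 - x := by linarith [hx.2]
          have h1 := abs_mul_jacobiWeight_le_of_neg_half_le hb hA.le hf hx.1.le (by linarith)
          rw [ham, neg_zero, Real.rpow_zero, mul_one] at h1
          refine (hker P t δ x ht1 hδ hx).trans ?_
          calc _ ≤ 2 * A * (2 * (1 - x)⁻¹) := by gcongr
            _ = _ := by ring
        · rw [setLIntegral_comp_sub_left (fun y => ENNReal.ofReal y⁻¹) 1 measurableSet_Ioc,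
            setLIntegral_inv hh0 hh2]
          exact ENNReal.ofReal_le_ofReal hlog2
    · have hu := uTwo_le (a := a) hb ht0 ht1
      rw [ham, Real.rpow_zero, mul_one] at hu
      calc _ ≤ (2 * B * (N : ℝ) ^ (2 * a) * A * (h ^ a / a) + 4 * A * (3 * Real.log N)) * 2 := by
            gcongr
        _ = (8 * B / a * (1 / 2)) * A * ((N : ℝ) ^ (2 * a) * h ^ a) + 24 * A * Real.log N := by
            ring
        _ = 8 * B / a * A * (1 / 2) + 24 * A * Real.log N := by rw [hha]; ring
        _ ≤ 8 * B / a * A * Real.log N + 24 * A * Real.log N := by gcongr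
        _ = _ := by ring

/-! ### The weighted bound for the Hilbert transform of a polynomial -/

lemma exists_truncHilbert_polynomial_bound_of_nonneg {a b : ℝ} (ha : -1 < a) (hb : -1 < b) :
    ∃ C : ℝ, 0 < C ∧ ∀ (N : ℕ) (P : ℝ[X]) (A t : ℝ), 2 ≤ N → P.natDegree ≤ N → 0 < A →
      (∀ x ∈ Set.Ioo (-1 : ℝ) 1, |P.eval x| * uPlus a b x ≤ A) → 0 ≤ t → t < 1 →
      HilbertExists a b (fun x => P.eval x) t ∧ ∀ ε, 0 < ε →
        |truncHilbert a b (fun x => P.eval x) t ε| * uTwo a b t ≤ C * A * Real.log N := by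
  obtain ⟨C₁, hC₁, hlip⟩ := exists_lipschitz_eval_mul_jacobiWeight a b
  obtain ⟨C₄, hC₄, hleft⟩ := exists_lintegral_regularizedKernel_left ha hb
  have hma := max_zero_neg_mem ha
  have hmb := max_zero_neg_mem hb
  set c₀ : ℝ := 2 * (1 / (1 - max 0 (-b))) with hc₀
  set c₂ : ℝ := 4 / (1 - max 0 (-a)) with hc₂
  have hc₀0 : 0 < c₀ := mul_pos two_pos (one_div_pos.2 (by linarith [hmb.2]))
  have hc₂0 : 0 < c₂ := div_pos (by norm_num) (by linarith [hma.2])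
  refine ⟨4 * c₀ + 4 * c₂ + 8 * C₁ + 48 + C₄, by positivity, ?_⟩
  intro N P A t hN hP hA hf ht0 ht1
  have hN0 : (0 : ℝ) < N := by exact_mod_cast (by omega : 0 < N)
  have hN2 : (2 : ℝ) ≤ N := by exact_mod_cast hN
  set s := 1 - t with hs
  have hs0 : 0 < s := by linarith
  -- The scale `(1 - t) / N²` is the one on which Markov's inequality controls `P u`.
  set δ : ℝ := s / N ^ 2 with hδ
  have hδ0 : 0 < δ := by positivity
  have hδs : δ ≤ s / 2 := by
    rw [hδ]
    exact div_le_div_of_nonneg_left hs0.le (by norm_num) (by nlinarith)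
  have hδN : δ * N ^ 2 = s := by rw [hδ]; field_simp
  set m := max 0 (-a) with hm
  set S : ℝ := s ^ (-m) with hS
  have hS1 : 1 ≤ S := Real.one_le_rpow_of_pos_of_le_one_of_nonpos hs0 (by linarith)
    (by linarith [hma.1])
  have hlogN := half_le_log hN
  obtain ⟨K₄, hK₄, hint₄, hbd₄⟩ := hleft N P A t δ hN hP hA hf ht0 ht1 hδs
  set g : ℝ → ENNReal := fun x => ENNReal.ofReal
    |regularizedKernel (fun x => P.eval x * jacobiWeight a b x) t δ x| with hg
  set K : ℝ := 2 * A * (1 / (1 - max 0 (-b))) + (K₄ + (4 * A * S * Real.log (s / (δ / 2)) +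
    (C₁ * A * N ^ 2 * s ^ (-m - 1) * (2 * δ) +
      (4 * A * S * Real.log (s / (δ / 2)) + c₂ * (A * S))))) with hK
  have hlogδ : Real.log (s / (δ / 2)) ≤ 3 * Real.log N := by
    have : s / (δ / 2) = 2 * (N : ℝ) ^ 2 := by rw [← hδN]; field_simp
    rw [this]
    exact log_two_mul_sq_le hN
  have hlogδ0 : 0 ≤ Real.log (s / (δ / 2)) :=
    Real.log_nonneg (by rw [le_div_iff₀ (by positivity)]; linarith)
  have h0 : 0 ≤ 2 * A * (1 / (1 - max 0 (-b))) :=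
    mul_nonneg (by positivity) (one_div_nonneg.2 (by linarith [hmb.2]))
  have hsm : 0 ≤ s ^ (-m - 1) := Real.rpow_nonneg hs0.le _
  have hS0 : 0 ≤ S := by linarith
  have hcover : Set.Ioo (-1 : ℝ) 1 ⊆ Set.Ioc (-1) (-1 / 2) ∪ (Set.Ioc (-1 / 2) (t - s) ∪
      (Set.Ioc (t - s) (t - δ) ∩ Set.Ioi (-1 / 2) ∪ (Set.Ioo (t - δ) (t + δ) ∪
        (Set.Ico (t + δ) (t + s / 2) ∪ Set.Ico (t + s / 2) 1)))) := by
    intro x hx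
    simp only [Set.mem_union, Set.mem_inter_iff, Set.mem_Ioc, Set.mem_Ioo, Set.mem_Ico,
      Set.mem_Ioi]
    have h1 := hx.1
    have h2 := hx.2
    rcases le_or_gt x (-1 / 2) with h3 | h3
    · exact Or.inl ⟨h1, h3⟩
    rcases le_or_gt x (t - s) with h4 | h4
    · exact Or.inr (Or.inl ⟨h3, h4⟩)
    rcases le_or_gt x (t - δ) with h5 | h5
    · exact Or.inr (Or.inr (Or.inl ⟨⟨h4, h5⟩, h3⟩))
    rcases lt_or_ge x (t + δ) with h6 | h6
    · exact Or.inr (Or.inr (Or.inr (Or.inl ⟨h5, h6⟩)))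
    rcases lt_or_ge x (t + s / 2) with h7 | h7
    · exact Or.inr (Or.inr (Or.inr (Or.inr (Or.inl ⟨h6, h7⟩))))
    · exact Or.inr (Or.inr (Or.inr (Or.inr (Or.inr ⟨h7, h2⟩))))
  have hint : ∫⁻ x in Set.Ioo (-1 : ℝ) 1, g x ≤ ENNReal.ofReal K := by
    obtain ⟨hr, hl⟩ := lintegral_regularizedKernel_intermediate ha hb hA.le hf ht0 ht1 hδ0 hδs
    refine (lintegral_mono_set hcover).trans ?_
    rw [hK, ENNReal.ofReal_add h0 (by positivity), ENNReal.ofReal_add hK₄ (by positivity),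
      ENNReal.ofReal_add (by positivity) (by positivity),
      ENNReal.ofReal_add (by positivity) (by positivity),
      ENNReal.ofReal_add (by positivity) (by positivity)]
    refine (lintegral_union_le _ _ _).trans (add_le_add ?_ ?_)
    · exact lintegral_regularizedKernel_far hb hA.le hf ht0 (by linarith)
    refine (lintegral_union_le _ _ _).trans (add_le_add hint₄ ?_)
    refine (lintegral_union_le _ _ _).trans (add_le_add hl ?_)
    refine (lintegral_union_le _ _ _).trans (add_le_add ?_ ?_)
    · exact lintegral_regularizedKernel_near (by positivity) fun x hx =>
        hlip N P A t (by omega) hP hA hf ht0 ht1 x (hx.le.trans hδs)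
    refine (lintegral_union_le _ _ _).trans (add_le_add hr ?_)
    exact lintegral_regularizedKernel_endpoint ha hb hA.le hf ht0 ht1 hδs
  have hsub : ∀ x, |x - t| < δ → x ∈ Set.Ioo (-1 : ℝ) 1 := by
    intro x hx
    rw [abs_sub_lt_iff] at hx
    exact ⟨by linarith [hx.2], by linarith [hx.1]⟩
  obtain ⟨hex, hbd⟩ := hilbertExists_of_lintegral_le (f := fun x => P.eval x)
    P.continuous.continuousOn hsub (by positivity) hint
  refine ⟨hex, fun ε hε => ?_⟩
  have hu0 : 0 ≤ uTwo a b t := uTwo_nonneg a b ⟨by linarith, ht1⟩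
  have hu : S * uTwo a b t ≤ 2 := by
    calc S * uTwo a b t ≤ S * (2 * s ^ m) := mul_le_mul_of_nonneg_left (uTwo_le hb ht0 ht1) hS0
      _ = 2 * (s ^ (-m) * s ^ m) := by rw [hS]; ring
      _ = 2 := by rw [← Real.rpow_add hs0, neg_add_cancel, Real.rpow_zero, mul_one]
  have hKle : K ≤ (2 * c₀ + 2 * c₂ + 4 * C₁ + 24) * A * Real.log N * S + K₄ := by
    have e0 : 2 * A * (1 / (1 - max 0 (-b))) ≤ 2 * c₀ * A * Real.log N * S := by
      calc _ = 2 * c₀ * A * (1 / 2) * 1 := by rw [hc₀]; ring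
        _ ≤ _ := by gcongr
    have e1 : C₁ * A * N ^ 2 * s ^ (-m - 1) * (2 * δ) ≤ 4 * C₁ * A * Real.log N * S := by
      have : s ^ (-m - 1) * s = S := by
        rw [hS, Real.rpow_sub_one hs0.ne', div_mul_cancel₀ _ hs0.ne']
      calc _ = 2 * C₁ * A * (s ^ (-m - 1) * (δ * N ^ 2)) := by ring
        _ = 4 * C₁ * A * (1 / 2) * S := by rw [hδN, this]; ring
        _ ≤ _ := by gcongr
    have e2 : 4 * A * S * Real.log (s / (δ / 2)) ≤ 12 * A * Real.log N * S := by
      calc _ ≤ 4 * A * S * (3 * Real.log N) := by gcongr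
        _ = _ := by ring
    have e3 : c₂ * (A * S) ≤ 2 * c₂ * A * Real.log N * S := by
      calc _ = 2 * c₂ * A * (1 / 2) * S := by ring
        _ ≤ _ := by gcongr
    rw [hK]
    linarith
  calc _ ≤ K * uTwo a b t := mul_le_mul_of_nonneg_right (hbd ε hε) hu0
    _ ≤ ((2 * c₀ + 2 * c₂ + 4 * C₁ + 24) * A * Real.log N * S + K₄) * uTwo a b t :=
        mul_le_mul_of_nonneg_right hKle hu0
    _ = (2 * c₀ + 2 * c₂ + 4 * C₁ + 24) * A * Real.log N * (S * uTwo a b t) +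
          K₄ * uTwo a b t := by ring
    _ ≤ (2 * c₀ + 2 * c₂ + 4 * C₁ + 24) * A * Real.log N * 2 + C₄ * A * Real.log N := by
        gcongr
    _ = _ := by ring

/-! ### Reflection at the origin -/

lemma jacobiWeight_neg (γ δ x : ℝ) : jacobiWeight γ δ (-x) = jacobiWeight δ γ x := by
  unfold jacobiWeight
  rw [sub_neg_eq_add, ← sub_eq_add_neg, mul_comm]

lemma uPlus_neg (a b x : ℝ) : uPlus a b (-x) = uPlus b a x := jacobiWeight_neg _ _ _

lemma uTwo_neg (a b x : ℝ) : uTwo a b (-x) = uTwo b a x := by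
  have h1 := uPlus_neg a b 1
  have h2 := uPlus_neg b a 1
  have h3 : uMinus a b (-1) = uMinus b a 1 := jacobiWeight_neg _ _ _
  have h4 : uMinus b a (-1) = uMinus a b 1 := jacobiWeight_neg _ _ _
  have h5 : uMinus a b (-x) = uMinus b a x := jacobiWeight_neg _ _ _
  unfold uTwo
  rw [h1, h2, h3, h4, h5, sub_neg_eq_add, ← sub_eq_add_neg]
  congr 1
  ring

lemma neg_mem_truncation_iff {t ε x : ℝ} :
    -x ∈ {x : ℝ | x ∈ Set.Ioo (-1 : ℝ) 1 ∧ ε ≤ |x - (-t)|} ↔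
      x ∈ {x : ℝ | x ∈ Set.Ioo (-1 : ℝ) 1 ∧ ε ≤ |x - t|} := by
  have h : |(-x) - (-t)| = |x - t| := by rw [← abs_neg]; congr 1; ring
  simp only [Set.mem_ofPred_eq, Set.mem_Ioo, h]
  constructor
  · rintro ⟨⟨h1, h2⟩, h3⟩
    exact ⟨⟨by linarith, by linarith⟩, h3⟩
  · rintro ⟨⟨h1, h2⟩, h3⟩
    exact ⟨⟨by linarith, by linarith⟩, h3⟩

lemma indicator_truncation_neg (a b : ℝ) (f : ℝ → ℝ) (t ε x : ℝ) :
    {x : ℝ | x ∈ Set.Ioo (-1 : ℝ) 1 ∧ ε ≤ |x - (-t)|}.indicator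
        (fun x => f (-x) / (x - (-t)) * jacobiWeight b a x) (-x) =
      -{x : ℝ | x ∈ Set.Ioo (-1 : ℝ) 1 ∧ ε ≤ |x - t|}.indicator
        (fun x => f x / (x - t) * jacobiWeight a b x) x := by
  by_cases hx : x ∈ {x : ℝ | x ∈ Set.Ioo (-1 : ℝ) 1 ∧ ε ≤ |x - t|}
  · rw [Set.indicator_of_mem hx, Set.indicator_of_mem (neg_mem_truncation_iff.2 hx), neg_neg,
      jacobiWeight_neg, ← neg_mul, ← div_neg]
    congr 2
    ring
  · rw [Set.indicator_of_notMem hx, Set.indicator_of_notMem (mt neg_mem_truncation_iff.1 hx),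
      neg_zero]

lemma truncHilbert_comp_neg (a b : ℝ) (f : ℝ → ℝ) (t ε : ℝ) :
    truncHilbert b a (fun x => f (-x)) (-t) ε = -truncHilbert a b f t ε := by
  unfold truncHilbert
  rw [← integral_indicator (measurableSet_truncation _ _),
    ← integral_indicator (measurableSet_truncation _ _), ← integral_neg,
    ← integral_neg_eq_self]
  simp only [indicator_truncation_neg]

lemma HilbertExists.of_comp_neg {a b t : ℝ} {f : ℝ → ℝ}
    (h : HilbertExists b a (fun x => f (-x)) (-t)) : HilbertExists a b f t := by
  obtain ⟨h1, L, hL⟩ := h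
  refine ⟨fun ε hε => ?_, -L, ?_⟩
  · have h2 := h1 ε hε
    rw [← integrable_indicator_iff (measurableSet_truncation _ _)] at h2 ⊢
    have h3 := h2.comp_neg.neg
    refine h3.congr (Eventually.of_forall fun x => ?_)
    simp only [Pi.neg_apply, indicator_truncation_neg, neg_neg]
  · refine hL.neg.congr fun ε => ?_
    rw [truncHilbert_comp_neg, neg_neg]

/-- The truncated Hilbert transforms of a polynomial `P` of degree at most `N` satisfy
`|H_ε P| u₂ ≤ C log N ‖P u₁‖`, uniformly in `ε` and `t`. -/
lemma exists_truncHilbert_polynomial_bound {a b : ℝ} (ha : -1 < a) (hb : -1 < b) :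
    ∃ C : ℝ, 0 < C ∧ ∀ (N : ℕ) (P : ℝ[X]) (A t : ℝ), 2 ≤ N → P.natDegree ≤ N → 0 < A →
      (∀ x ∈ Set.Ioo (-1 : ℝ) 1, |P.eval x| * uPlus a b x ≤ A) → t ∈ Set.Ioo (-1 : ℝ) 1 →
      HilbertExists a b (fun x => P.eval x) t ∧ ∀ ε, 0 < ε →
        |truncHilbert a b (fun x => P.eval x) t ε| * uTwo a b t ≤ C * A * Real.log N := by
  obtain ⟨C₁, hC₁, h₁⟩ := exists_truncHilbert_polynomial_bound_of_nonneg ha hb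
  obtain ⟨C₂, hC₂, h₂⟩ := exists_truncHilbert_polynomial_bound_of_nonneg hb ha
  refine ⟨C₁ + C₂, by positivity, ?_⟩
  intro N P A t hN hP hA hf ht
  have hlog : 0 ≤ A * Real.log N := mul_nonneg hA.le (by linarith [half_le_log hN])
  rcases le_total 0 t with ht0 | ht0
  · obtain ⟨hex, hbd⟩ := h₁ N P A t hN hP hA hf ht0 ht.2
    refine ⟨hex, fun ε hε => (hbd ε hε).trans ?_⟩
    nlinarith
  · obtain ⟨hex, hbd⟩ := h₂ N (P.comp (-X)) A (-t) hN (by rwa [natDegree_comp, natDegree_neg,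
      natDegree_X, mul_one]) hA (fun x hx => by
        rw [eval_comp, eval_neg, eval_X, ← uPlus_neg]
        exact hf (-x) ⟨by linarith [hx.2], by linarith [hx.1]⟩) (by linarith) (by linarith [ht.1])
    simp only [eval_comp, eval_neg, eval_X] at hex hbd
    refine ⟨HilbertExists.of_comp_neg (f := fun x => P.eval x) hex, fun ε hε => ?_⟩
    have h := hbd ε hε
    rw [truncHilbert_comp_neg a b (fun x => P.eval x), abs_neg, uTwo_neg] at h
    refine h.trans ?_
    nlinarith

/-! ### Weighted uniform norms and best approximation -/

lemma MemC0.sub {γ δ : ℝ} {f g : ℝ → ℝ} (hf : MemC0 γ δ f) (hg : MemC0 γ δ g) :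
    MemC0 γ δ (fun x => f x - g x) := by
  obtain ⟨hf1, ⟨l1, hl1, hl1'⟩, ⟨l2, hl2, hl2'⟩⟩ := hf
  obtain ⟨hg1, ⟨k1, hk1, hk1'⟩, ⟨k2, hk2, hk2'⟩⟩ := hg
  refine ⟨hf1.sub hg1, ⟨l1 - k1, ?_, fun h => by rw [hl1' h, hk1' h, sub_zero]⟩,
    ⟨l2 - k2, ?_, fun h => by rw [hl2' h, hk2' h, sub_zero]⟩⟩
  · simpa only [sub_mul] using hl1.sub hk1
  · simpa only [sub_mul] using hl2.sub hk2

lemma memC0_polynomial {γ δ : ℝ} (hγ : 0 ≤ γ) (hδ : 0 ≤ δ) (P : ℝ[X]) :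
    MemC0 γ δ (fun x => P.eval x) := by
  have hc : Continuous fun x => P.eval x * jacobiWeight γ δ x := by
    unfold jacobiWeight
    exact P.continuous.mul
      (((continuous_const.sub continuous_id).rpow_const fun _ => Or.inr hγ).mul
        ((continuous_const.add continuous_id).rpow_const fun _ => Or.inr hδ))
  refine ⟨P.continuous.continuousOn,
    ⟨_, (hc.tendsto 1).mono_left nhdsWithin_le_nhds, fun h => ?_⟩,
    ⟨_, (hc.tendsto (-1)).mono_left nhdsWithin_le_nhds, fun h => ?_⟩⟩
  · simp [jacobiWeight, Real.zero_rpow h.ne']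
  · simp [jacobiWeight, Real.zero_rpow h.ne']

lemma MemC0.le_normC0 {γ δ : ℝ} {f : ℝ → ℝ} (hf : MemC0 γ δ f) {x : ℝ}
    (hx : x ∈ Set.Ioo (-1 : ℝ) 1) : |f x| * jacobiWeight γ δ x ≤ normC0 γ δ f := by
  obtain ⟨hf1, ⟨l1, hl1, -⟩, ⟨l2, hl2, -⟩⟩ := hf
  have hcont : ContinuousOn
      (extendFrom (Set.Ioo (-1) 1) fun x => f x * jacobiWeight γ δ x) (Set.Icc (-1 : ℝ) 1) :=
    continuousOn_Icc_extendFrom_Ioo (hf1.mul (continuousOn_jacobiWeight γ δ)) hl2 hl1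
  obtain ⟨M, hM⟩ := isCompact_Icc.exists_bound_of_continuousOn hcont
  have hbdd : BddAbove (Set.range fun x : Set.Ioo (-1 : ℝ) 1 => |f x| * jacobiWeight γ δ x) := by
    refine ⟨M, ?_⟩
    rintro _ ⟨y, rfl⟩
    have h1 := hM y (Set.Ioo_subset_Icc_self y.2)
    have hcy : Tendsto (fun x => f x * jacobiWeight γ δ x) (𝓝[Set.Ioo (-1) 1] (y : ℝ))
        (𝓝 (f y * jacobiWeight γ δ y)) := (hf1.mul (continuousOn_jacobiWeight γ δ)) y y.2
    have h2 := extendFrom_eq (subset_closure y.2) hcy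
    rw [h2, Real.norm_eq_abs, abs_mul, abs_of_pos (jacobiWeight_pos γ δ y.2)] at h1
    exact h1
  exact le_ciSup hbdd ⟨x, hx⟩

lemma normC0_nonneg (γ δ : ℝ) (f : ℝ → ℝ) : 0 ≤ normC0 γ δ f :=
  Real.iSup_nonneg fun x => mul_nonneg (abs_nonneg _) (jacobiWeight_pos γ δ x.2).le

lemma bddBelow_range_normC0 (γ δ : ℝ) (f : ℝ → ℝ) (n : ℕ) :
    BddBelow (Set.range fun P : {P : ℝ[X] // P.natDegree ≤ n} =>
      normC0 γ δ (fun x => f x - P.1.eval x)) :=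
  ⟨0, by rintro _ ⟨P, rfl⟩; exact normC0_nonneg _ _ _⟩

lemma bestError_nonneg (γ δ : ℝ) (f : ℝ → ℝ) (n : ℕ) : 0 ≤ bestError γ δ f n :=
  Real.iInf_nonneg fun _ => normC0_nonneg _ _ _

lemma bestError_antitone (γ δ : ℝ) (f : ℝ → ℝ) : Antitone (bestError γ δ f) := by
  intro m n hmn
  have : Nonempty {P : ℝ[X] // P.natDegree ≤ m} := ⟨⟨0, by simp⟩⟩
  exact le_ciInf fun P => ciInf_le (bddBelow_range_normC0 γ δ f n) ⟨P.1, P.2.trans hmn⟩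

lemma exists_normC0_sub_lt (γ δ : ℝ) (f : ℝ → ℝ) (n : ℕ) {A : ℝ} (hA : bestError γ δ f n < A) :
    ∃ P : ℝ[X], P.natDegree ≤ n ∧ normC0 γ δ (fun x => f x - P.eval x) < A := by
  have : Nonempty {P : ℝ[X] // P.natDegree ≤ n} := ⟨⟨0, by simp⟩⟩
  obtain ⟨P, hP⟩ := exists_lt_of_ciInf_lt hA
  exact ⟨P.1, P.2, hP⟩

lemma normBesov_nonneg (r γ δ : ℝ) (f : ℝ → ℝ) : 0 ≤ normBesov r γ δ f :=
  add_nonneg (normC0_nonneg _ _ _) (tsum_nonneg fun n =>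
    mul_nonneg (Real.rpow_nonneg (by positivity) _) (bestError_nonneg _ _ _ _))

/-- `E_k(f) ≤ C k^{-r} ‖f‖_{B_r}`: by monotonicity of the errors, the terms with indices between
`k / 2` and `k` already contribute a multiple of `k ^ r E_k(f)` to the Besov norm. -/
lemma bestError_mul_rpow_le {r γ δ : ℝ} {f : ℝ → ℝ} (hf : MemBesov r γ δ f) {k : ℕ} (hk : 1 ≤ k) :
    bestError γ δ f k * (k : ℝ) ^ r ≤ 2 * 2 ^ |r - 1| * normBesov r γ δ f := by
  have hk1 : (1 : ℝ) ≤ k := by exact_mod_cast hk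
  have hk0 : (0 : ℝ) < k := by linarith
  set E := bestError γ δ f k with hE
  have hE0 : 0 ≤ E := bestError_nonneg _ _ _ _
  have hterm : ∀ n ∈ Finset.Ico (k / 2) k,
      (2 ^ |r - 1|)⁻¹ * (k : ℝ) ^ (r - 1) * E ≤
        ((n : ℝ) + 2) ^ (r - 1) * bestError γ δ f (n + 1) := by
    intro n hn
    rw [Finset.mem_Ico] at hn
    have h1 : (k : ℝ) ≤ 2 * (n + 2) := by exact_mod_cast (by omega : k ≤ 2 * (n + 2))
    have h2 : (n : ℝ) + 2 ≤ 2 * k := by exact_mod_cast (by omega : n + 2 ≤ 2 * k)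
    have h3 := rpow_le_two_rpow_abs_mul (by positivity : (0 : ℝ) < (n : ℝ) + 2)
      (⟨by linarith, h1⟩ : (k : ℝ) ∈ Set.Icc (((n : ℝ) + 2) / 2) (2 * ((n : ℝ) + 2))) (r - 1)
    have h4 : E ≤ bestError γ δ f (n + 1) := bestError_antitone γ δ f (by omega)
    refine mul_le_mul ?_ h4 hE0 (Real.rpow_nonneg (by positivity) _)
    rw [inv_mul_le_iff₀ (by positivity)]
    exact h3
  have hsum : ((Finset.Ico (k / 2) k).card : ℝ) * ((2 ^ |r - 1|)⁻¹ * (k : ℝ) ^ (r - 1) * E) ≤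
      ∑' n : ℕ, ((n : ℝ) + 2) ^ (r - 1) * bestError γ δ f (n + 1) := by
    rw [← nsmul_eq_mul]
    refine (Finset.card_nsmul_le_sum _ _ _ hterm).trans ?_
    exact hf.2.sum_le_tsum _ fun n _ =>
      mul_nonneg (Real.rpow_nonneg (by positivity) _) (bestError_nonneg _ _ _ _)
  have hcard : (k : ℝ) / 2 ≤ ((Finset.Ico (k / 2) k).card : ℝ) := by
    rw [Nat.card_Ico, div_le_iff₀ two_pos]
    exact_mod_cast (by omega : k ≤ (k - k / 2) * 2)
  have hle : (k : ℝ) / 2 * ((2 ^ |r - 1|)⁻¹ * (k : ℝ) ^ (r - 1) * E) ≤ normBesov r γ δ f := by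
    have h5 : 0 ≤ (2 ^ |r - 1|)⁻¹ * (k : ℝ) ^ (r - 1) * E := by positivity
    have := mul_le_mul_of_nonneg_right hcard h5
    unfold normBesov
    linarith [normC0_nonneg γ δ f]
  have hkr : (k : ℝ) ^ r = k * (k : ℝ) ^ (r - 1) := by
    rw [Real.rpow_sub_one hk0.ne', mul_div_cancel₀ _ hk0.ne']
  calc E * (k : ℝ) ^ r
      = 2 * 2 ^ |r - 1| * ((k : ℝ) / 2 * ((2 ^ |r - 1|)⁻¹ * (k : ℝ) ^ (r - 1) * E)) := by
        rw [hkr]; field_simp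
    _ ≤ _ := mul_le_mul_of_nonneg_left hle (by positivity)

/-- Polynomials of near-best approximation of a function in `B_r(v)`. The slack `η` is needed when
`E_k(f) = 0`, as the infimum defining `E_k(f)` is not known to be attained. -/
lemma exists_polynomial_near {r γ δ η : ℝ} (hη : 0 < η) {f : ℝ → ℝ} (hγ : 0 ≤ γ) (hδ : 0 ≤ δ)
    (hf : MemBesov r γ δ f) {k : ℕ} (hk : 1 ≤ k) :
    ∃ P : ℝ[X], P.natDegree ≤ k ∧ ∀ x ∈ Set.Ioo (-1 : ℝ) 1,
      |f x - P.eval x| * jacobiWeight γ δ x ≤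
        2 * 2 ^ |r - 1| * (normBesov r γ δ f + η) * (k : ℝ) ^ (-r) := by
  have hk0 : (0 : ℝ) < k := by exact_mod_cast (by omega : 0 < k)
  have hlt : bestError γ δ f k < 2 * 2 ^ |r - 1| * (normBesov r γ δ f + η) * (k : ℝ) ^ (-r) := by
    rw [Real.rpow_neg hk0.le, ← div_eq_mul_inv, lt_div_iff₀ (by positivity)]
    refine (bestError_mul_rpow_le hf hk).trans_lt ?_
    exact mul_lt_mul_of_pos_left (by linarith) (by positivity)
  obtain ⟨P, hP, hPn⟩ := exists_normC0_sub_lt γ δ f k hlt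
  exact ⟨P, hP, fun x hx => ((hf.1.sub (memC0_polynomial hγ hδ P)).le_normC0 hx).trans hPn.le⟩

/-- The filtered polynomials approximate as well as the best polynomials of degree `n - m`. -/
lemma abs_sub_vpPoly_le {α β γ δ M A : ℝ} (hα : -1 < α) (hβ : -1 < β) (hγ : 0 ≤ γ) (hδ : 0 ≤ δ)
    {n m : ℕ} (hm : 0 < m) (hmn : m < n)
    (hM : ∀ f : ℝ → ℝ, MemC0 γ δ f →
      normC0 γ δ (fun x => (vpPoly α β n m f).eval x) ≤ M * normC0 γ δ f)
    {f : ℝ → ℝ} (hf : MemC0 γ δ f) {P : ℝ[X]} (hP : P.natDegree ≤ n - m)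
    (hA : ∀ x ∈ Set.Ioo (-1 : ℝ) 1, |f x - P.eval x| * jacobiWeight γ δ x ≤ A)
    {x : ℝ} (hx : x ∈ Set.Ioo (-1 : ℝ) 1) :
    |f x - (vpPoly α β n m f).eval x| * jacobiWeight γ δ x ≤ (1 + |M|) * A := by
  have hmem := hf.sub (memC0_polynomial hγ hδ P)
  have hV := hM _ hmem
  rw [vpPoly_sub, vpPoly_eval_eq_self hα hβ hm hmn hP] at hV
  have hnorm : normC0 γ δ (fun x => f x - P.eval x) ≤ A := by
    have : Nonempty (Set.Ioo (-1 : ℝ) 1) := ⟨⟨x, hx⟩⟩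
    exact ciSup_le fun y => hA y y.2
  have h1 := (memC0_polynomial hγ hδ (vpPoly α β n m f - P)).le_normC0 hx
  have h2 : M * normC0 γ δ (fun x => f x - P.eval x) ≤ |M| * A :=
    (mul_le_mul_of_nonneg_right (le_abs_self M) (normC0_nonneg _ _ _)).trans
      (mul_le_mul_of_nonneg_left hnorm (abs_nonneg M))
  have h3 : |f x - (vpPoly α β n m f).eval x| ≤
      |f x - P.eval x| + |(vpPoly α β n m f - P).eval x| := by
    rw [eval_sub, abs_sub_comm ((vpPoly α β n m f).eval x)]
    exact abs_sub_le _ _ _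
  have hw := (jacobiWeight_pos γ δ hx).le
  calc _ ≤ (|f x - P.eval x| + |(vpPoly α β n m f - P).eval x|) * jacobiWeight γ δ x :=
        mul_le_mul_of_nonneg_right h3 hw
    _ ≤ A + |M| * A := by
        rw [add_mul]
        exact add_le_add (hA x hx) (h1.trans (hV.trans h2))
    _ = _ := by ring

/-! ### The Hilbert transform of a series of polynomials -/

lemma HilbertExists.add {a b t : ℝ} {f g : ℝ → ℝ} (hf : HilbertExists a b f t)
    (hg : HilbertExists a b g t) :
    HilbertExists a b (fun x => f x + g x) t ∧
      hilbert a b (fun x => f x + g x) t = hilbert a b f t + hilbert a b g t := by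
  obtain ⟨hf1, L, hL⟩ := hf
  obtain ⟨hg1, K, hK⟩ := hg
  have heq : ∀ x, (f x + g x) / (x - t) * jacobiWeight a b x =
      f x / (x - t) * jacobiWeight a b x + g x / (x - t) * jacobiWeight a b x := fun x => by ring
  have hT : Tendsto (truncHilbert a b (fun x => f x + g x) t) (𝓝[>] 0) (𝓝 (L + K)) := by
    refine (hL.add hK).congr' ?_
    filter_upwards [self_mem_nhdsWithin] with ε hε
    unfold truncHilbert
    simp only [heq]
    exact (integral_add (hf1 ε hε) (hg1 ε hε)).symm
  refine ⟨⟨fun ε hε => ?_, L + K, hT⟩, ?_⟩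
  · simp only [heq]
    exact (hf1 ε hε).add (hg1 ε hε)
  · unfold hilbert
    rw [hT.limUnder_eq, hL.limUnder_eq, hK.limUnder_eq]

lemma uTwo_pos (a b : ℝ) {x : ℝ} (hx : x ∈ Set.Ioo (-1 : ℝ) 1) : 0 < uTwo a b x :=
  div_pos (jacobiWeight_pos _ _ hx) (zero_lt_one.trans_le (one_le_uTwo_denominator a b x))

/-- Truncated Hilbert transforms may be computed termwise for a series converging geometrically in
the weighted uniform norm. -/
lemma hasSum_truncHilbert {a b A q t ε : ℝ} (ha : -1 < a) (hb : -1 < b) (hq0 : 0 < q)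
    (hq1 : q < 1) {R : ℝ → ℝ} {D : ℕ → ℝ[X]} (hR : ContinuousOn R (Set.Ioo (-1) 1))
    (hD : ∀ j, ∀ x ∈ Set.Ioo (-1 : ℝ) 1, |(D j).eval x| * uPlus a b x ≤ A * q ^ j)
    (hsum : ∀ x ∈ Set.Ioo (-1 : ℝ) 1, HasSum (fun j => (D j).eval x) (R x)) (hε : 0 < ε) :
    IntegrableOn (fun x => R x / (x - t) * jacobiWeight a b x)
        {x : ℝ | x ∈ Set.Ioo (-1) 1 ∧ ε ≤ |x - t|} ∧
      HasSum (fun j => truncHilbert a b (fun x => (D j).eval x) t ε) (truncHilbert a b R t ε) := by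
  set S : Set ℝ := {x : ℝ | x ∈ Set.Ioo (-1) 1 ∧ ε ≤ |x - t|} with hS
  have hSm : MeasurableSet S := measurableSet_truncation t ε
  have hSsub : S ⊆ Set.Ioo (-1) 1 := fun x hx => hx.1
  set v : ℝ → ℝ := jacobiWeight (-max 0 (-a)) (-max 0 (-b)) with hv
  have hvint : IntegrableOn v S :=
    (integrableOn_jacobiWeight (by linarith [(max_zero_neg_mem ha).2])
      (by linarith [(max_zero_neg_mem hb).2])).mono_set hSsub
  have hbound : ∀ (g : ℝ → ℝ) (B : ℝ), ∀ x ∈ S, |g x| * uPlus a b x ≤ B →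
      ‖g x / (x - t) * jacobiWeight a b x‖ ≤ B / ε * v x := by
    intro g B x hx hB
    have hu := uPlus_pos a b hx.1
    have hvx : 0 < v x := jacobiWeight_pos _ _ hx.1
    have hB0 : 0 ≤ B := le_trans (mul_nonneg (abs_nonneg _) hu.le) hB
    rw [Real.norm_eq_abs, abs_mul, abs_div, abs_of_pos (jacobiWeight_pos a b hx.1),
      jacobiWeight_eq_uPlus_mul a b hx.1]
    change |g x| / |x - t| * (uPlus a b x * v x) ≤ B / ε * v x
    calc |g x| / |x - t| * (uPlus a b x * v x) = |g x| * uPlus a b x / |x - t| * v x := by ring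
      _ ≤ B / ε * v x := by
          refine mul_le_mul_of_nonneg_right ?_ hvx.le
          exact div_le_div₀ hB0 hB hε hx.2
  have hmeas : ∀ g : ℝ → ℝ, ContinuousOn g (Set.Ioo (-1) 1) →
      AEStronglyMeasurable (fun x => g x / (x - t) * jacobiWeight a b x) (volume.restrict S) := by
    intro g hg
    have h1 : AEStronglyMeasurable g (volume.restrict S) :=
      (hg.mono hSsub).aestronglyMeasurable hSm
    have h2 : AEStronglyMeasurable (jacobiWeight a b) (volume.restrict S) :=
      ((continuousOn_jacobiWeight a b).mono hSsub).aestronglyMeasurable hSm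
    have h3 : Measurable (fun x : ℝ => (x - t)⁻¹) := by fun_prop
    simp only [div_eq_mul_inv]
    exact (h1.mul h3.aestronglyMeasurable).mul h2
  have hgeo : Summable fun j : ℕ => A * q ^ j :=
    (summable_geometric_of_lt_one hq0.le hq1).mul_left A
  have hRbd : ∀ x ∈ S, |R x| * uPlus a b x ≤ ∑' j : ℕ, A * q ^ j := by
    intro x hx
    have h1 : HasSum (fun j => (D j).eval x * uPlus a b x) (R x * uPlus a b x) :=
      (hsum x hx.1).mul_right _
    rw [← abs_of_pos (uPlus_pos a b hx.1), ← abs_mul, ← Real.norm_eq_abs, ← h1.tsum_eq]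
    refine tsum_of_norm_bounded hgeo.hasSum fun j => ?_
    rw [Real.norm_eq_abs, abs_mul, abs_of_pos (uPlus_pos a b hx.1)]
    exact hD j x hx.1
  refine ⟨?_, ?_⟩
  · refine (hvint.const_mul ((∑' j : ℕ, A * q ^ j) / ε)).mono' (hmeas R hR) ?_
    exact (ae_restrict_iff' hSm).2 (Eventually.of_forall fun x hx => hbound R _ x hx (hRbd x hx))
  · unfold truncHilbert
    refine hasSum_integral_of_dominated_convergence (fun j x => A * q ^ j / ε * v x)
      (fun j => hmeas _ (D j).continuous.continuousOn) (fun j => ?_) ?_ ?_ ?_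
    · exact (ae_restrict_iff' hSm).2
        (Eventually.of_forall fun x hx => hbound (fun x => (D j).eval x) _ x hx (hD j x hx.1))
    · exact Eventually.of_forall fun x => (hgeo.div_const ε).mul_right (v x)
    · simp only [tsum_mul_right]
      exact hvint.const_mul _
    · refine (ae_restrict_iff' hSm).2 (Eventually.of_forall fun x hx => ?_)
      exact ((hsum x hx.1).div_const (x - t)).mul_right _

lemma log_two_pow_mul_le {n : ℕ} (hn : 2 ≤ n) (j : ℕ) :
    Real.log ((2 ^ (j + 1) * n : ℕ) : ℝ) ≤ ((j : ℝ) + 2) * Real.log n := by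
  have hn0 : (0 : ℝ) < n := by exact_mod_cast (by omega : 0 < n)
  have h1 : Real.log 2 ≤ Real.log n := Real.log_le_log (by norm_num) (by exact_mod_cast hn)
  push_cast
  rw [Real.log_mul (by positivity) hn0.ne', Real.log_pow]
  push_cast
  have := mul_le_mul_of_nonneg_left h1 (by positivity : (0 : ℝ) ≤ (j : ℝ) + 1)
  linarith

/-- If `R = ∑ D_j` with polynomials `D_j` of degree at most `2^{j+1} n` and weighted norm at most
`A q^j`, `q < 1`, then `|H R| u₂ ≤ C A log n`: the factor `j` in `log (2^{j+1} n)` is absorbed by the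
geometric decay. -/
lemma exists_hilbert_series_bound {a b q : ℝ} (ha : -1 < a) (hb : -1 < b) (hq0 : 0 < q)
    (hq1 : q < 1) :
    ∃ C : ℝ, 0 < C ∧ ∀ (n : ℕ) (R : ℝ → ℝ) (D : ℕ → ℝ[X]) (A t : ℝ), 2 ≤ n → 0 < A →
      ContinuousOn R (Set.Ioo (-1) 1) → (∀ j, (D j).natDegree ≤ 2 ^ (j + 1) * n) →
      (∀ j, ∀ x ∈ Set.Ioo (-1 : ℝ) 1, |(D j).eval x| * uPlus a b x ≤ A * q ^ j) →
      (∀ x ∈ Set.Ioo (-1 : ℝ) 1, HasSum (fun j => (D j).eval x) (R x)) →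
      t ∈ Set.Ioo (-1 : ℝ) 1 →
      HilbertExists a b R t ∧ |hilbert a b R t| * uTwo a b t ≤ C * A * Real.log n := by
  obtain ⟨C, hC, hbound⟩ := exists_truncHilbert_polynomial_bound ha hb
  have hsummable : Summable fun j : ℕ => ((j : ℝ) + 2) * q ^ j := by
    have h1 : Summable fun j : ℕ => (j : ℝ) * q ^ j := by
      simpa using summable_pow_mul_geometric_of_norm_lt_one 1
        (by rwa [Real.norm_eq_abs, abs_of_pos hq0] : ‖q‖ < 1)
    simp only [add_mul]
    exact h1.add ((summable_geometric_of_lt_one hq0.le hq1).mul_left 2)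
  have hσ : 0 < ∑' j : ℕ, ((j : ℝ) + 2) * q ^ j :=
    hsummable.tsum_pos (fun j => by positivity) 0 (by norm_num)
  refine ⟨C * ∑' j : ℕ, ((j : ℝ) + 2) * q ^ j, by positivity, ?_⟩
  intro n R D A t hn hA hR hdeg hD hsum ht
  have hu := uTwo_pos a b ht
  have hlogn := half_le_log hn
  have hN : ∀ j : ℕ, 2 ≤ 2 ^ (j + 1) * n := fun j =>
    hn.trans (Nat.le_mul_of_pos_left n (by positivity))
  set bd : ℕ → ℝ := fun j => C * A * Real.log n * (((j : ℝ) + 2) * q ^ j) with hbd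
  have hbdsum : Summable bd := hsummable.mul_left _
  have hpoly := fun j => hbound (2 ^ (j + 1) * n) (D j) (A * q ^ j) t (hN j) (hdeg j)
    (by positivity) (hD j) ht
  have hle : ∀ j ε, 0 < ε →
      |truncHilbert a b (fun x => (D j).eval x) t ε| * uTwo a b t ≤ bd j := by
    intro j ε hε
    refine ((hpoly j).2 ε hε).trans ?_
    calc C * (A * q ^ j) * Real.log ((2 ^ (j + 1) * n : ℕ) : ℝ)
        ≤ C * (A * q ^ j) * (((j : ℝ) + 2) * Real.log n) := by
          have := log_two_pow_mul_le hn j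
          gcongr
      _ = bd j := by rw [hbd]; ring
  have hS := fun ε (hε : (0 : ℝ) < ε) => hasSum_truncHilbert (t := t) ha hb hq0 hq1 hR hD hsum hε
  choose L hL using fun j => (hpoly j).1.2
  have hlim : Tendsto (truncHilbert a b R t) (𝓝[>] 0) (𝓝 (∑' j, L j)) := by
    have h1 : Tendsto (fun ε => ∑' j, truncHilbert a b (fun x => (D j).eval x) t ε) (𝓝[>] 0)
        (𝓝 (∑' j, L j)) := by
      refine tendsto_tsum_of_dominated_convergence (bound := fun j => bd j / uTwo a b t)
        (hbdsum.div_const _) hL ?_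
      filter_upwards [self_mem_nhdsWithin] with ε hε j
      rw [Real.norm_eq_abs, le_div_iff₀ hu]
      exact hle j ε hε
    refine h1.congr' ?_
    filter_upwards [self_mem_nhdsWithin] with ε hε
    exact (hS ε hε).2.tsum_eq
  refine ⟨⟨fun ε hε => (hS ε hε).1, _, hlim⟩, ?_⟩
  have hbdR : ∀ ε, 0 < ε → |truncHilbert a b R t ε| * uTwo a b t ≤ ∑' j, bd j := by
    intro ε hε
    have h1 := (hS ε hε).2.mul_right (uTwo a b t)
    rw [← abs_of_pos hu, ← abs_mul, ← Real.norm_eq_abs, ← h1.tsum_eq]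
    refine tsum_of_norm_bounded hbdsum.hasSum fun j => ?_
    rw [Real.norm_eq_abs, abs_mul, abs_of_pos hu]
    exact hle j ε hε
  have hfin : |∑' j, L j| * uTwo a b t ≤ ∑' j, bd j := by
    refine le_of_tendsto (hlim.abs.mul_const (uTwo a b t)) ?_
    filter_upwards [self_mem_nhdsWithin] with ε hε
    exact hbdR ε hε
  rw [hilbert, hlim.limUnder_eq]
  refine hfin.trans (le_of_eq ?_)
  rw [hbd, tsum_mul_left]
  ring

/-! ### The quadrature error -/

/-- The error of the filtered approximation of `f ∈ B_r(v)` is a telescoping series of near-best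
polynomials of degrees `2^j n`, whose terms have weighted norms `O(2^{-jr} n^{-r})`. -/
lemma exists_polynomial_series {α β γ δ c₁ r M η : ℝ} (hα : -1 < α) (hβ : -1 < β) (hγ : 0 ≤ γ)
    (hδ : 0 ≤ δ) (hc₁ : 1 < c₁) (hr : 0 < r) (hη : 0 < η) {n m : ℕ} (hm : 0 < m) (hmn : m < n)
    (hc : c₁ * m ≤ n)
    (hM : ∀ f : ℝ → ℝ, MemC0 γ δ f →
      normC0 γ δ (fun x => (vpPoly α β n m f).eval x) ≤ M * normC0 γ δ f)
    {f : ℝ → ℝ} (hf : MemBesov r γ δ f) :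
    ∃ D : ℕ → ℝ[X], (∀ j, (D j).natDegree ≤ 2 ^ (j + 1) * n) ∧
      (∀ j, ∀ x ∈ Set.Ioo (-1 : ℝ) 1, |(D j).eval x| * jacobiWeight γ δ x ≤
        2 * 2 ^ |r - 1| * (1 + 2 ^ r + (1 + |M|) * (1 - 1 / c₁) ^ (-r)) *
          (normBesov r γ δ f + η) * (n : ℝ) ^ (-r) * ((2 : ℝ) ^ (-r)) ^ j) ∧
      ∀ x ∈ Set.Ioo (-1 : ℝ) 1,
        HasSum (fun j => (D j).eval x) (f x - (vpPoly α β n m f).eval x) := by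
  have hn0 : (0 : ℝ) < n := by exact_mod_cast (by omega : 0 < n)
  set B := normBesov r γ δ f + η with hB
  have hB0 : 0 < B := by linarith [normBesov_nonneg r γ δ f]
  set G : ℝ := 2 * 2 ^ |r - 1| with hG
  have hG0 : 0 < G := by positivity
  set κ : ℝ := 1 - 1 / c₁ with hκ
  have hκ0 : 0 < κ := by
    have : 1 / c₁ < 1 := by rw [div_lt_one (by linarith)]; exact hc₁
    linarith
  set q : ℝ := 2 ^ (-r) with hq
  have hq0 : 0 < q := by positivity
  have hq1 : q < 1 := Real.rpow_lt_one_of_one_lt_of_neg (by norm_num) (by linarith)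
  set V := vpPoly α β n m f with hV
  have hpow : ∀ j : ℕ, ((2 ^ j * n : ℕ) : ℝ) ^ (-r) = (n : ℝ) ^ (-r) * q ^ j := by
    intro j
    push_cast
    rw [Real.mul_rpow (by positivity) hn0.le, hq, ← Real.rpow_natCast, ← Real.rpow_natCast,
      ← Real.rpow_mul (by norm_num), ← Real.rpow_mul (by norm_num), mul_comm (j : ℝ), mul_comm]
  have hnear := fun j : ℕ => exists_polynomial_near hη hγ hδ hf
    (Nat.mul_pos (Nat.two_pow_pos j) (by omega) : 1 ≤ 2 ^ j * n)
  choose P hPdeg hPbd using hnear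
  simp only [hpow] at hPbd
  obtain ⟨Q, hQdeg, hQbd⟩ := exists_polynomial_near hη hγ hδ hf (by omega : 1 ≤ n - m)
  have hVbd : ∀ x ∈ Set.Ioo (-1 : ℝ) 1, |f x - V.eval x| * jacobiWeight γ δ x ≤
      (1 + |M|) * (G * B * (κ ^ (-r) * (n : ℝ) ^ (-r))) := by
    intro x hx
    refine (abs_sub_vpPoly_le hα hβ hγ hδ hm hmn hM hf.1 hQdeg hQbd hx).trans ?_
    refine mul_le_mul_of_nonneg_left ?_ (by positivity)
    refine mul_le_mul_of_nonneg_left ?_ (by positivity)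
    rw [← Real.mul_rpow hκ0.le hn0.le]
    refine Real.rpow_le_rpow_of_nonpos (by positivity) ?_ (by linarith)
    rw [Nat.cast_sub hmn.le, hκ, sub_mul, one_mul, one_div_mul_eq_div]
    have : (m : ℝ) ≤ n / c₁ := by rw [le_div_iff₀ (by linarith)]; linarith
    linarith
  have hw : ∀ x ∈ Set.Ioo (-1 : ℝ) 1, 0 < jacobiWeight γ δ x := fun x hx => jacobiWeight_pos γ δ hx
  set D : ℕ → ℝ[X] := fun j => Nat.casesOn j (P 0 - V) fun i => P (i + 1) - P i with hD
  have hD0 : D 0 = P 0 - V := rfl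
  have hDs : ∀ i, D (i + 1) = P (i + 1) - P i := fun i => rfl
  have htri : ∀ (u v : ℝ[X]) (x : ℝ), |(u - v).eval x| ≤ |f x - u.eval x| + |f x - v.eval x| := by
    intro u v x
    rw [eval_sub, abs_sub_comm (f x)]
    exact abs_sub_le _ _ _
  have hDbd : ∀ j, ∀ x ∈ Set.Ioo (-1 : ℝ) 1, |(D j).eval x| * jacobiWeight γ δ x ≤
      G * (1 + 2 ^ r + (1 + |M|) * κ ^ (-r)) * B * (n : ℝ) ^ (-r) * q ^ j := by
    intro j x hx
    have h2r : 0 < (2 : ℝ) ^ r := by positivity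
    cases j with
    | zero =>
      rw [hD0]
      have h1 := hPbd 0 x hx
      have h2 := hVbd x hx
      have h3 := mul_le_mul_of_nonneg_right (htri (P 0) V x) (hw x hx).le
      have h4 : 0 ≤ G * 2 ^ r * B * (n : ℝ) ^ (-r) := by positivity
      rw [pow_zero] at h1 ⊢
      linarith
    | succ i =>
      rw [hDs]
      have h1 := hPbd i x hx
      have h2 := hPbd (i + 1) x hx
      have h3 := mul_le_mul_of_nonneg_right (htri (P (i + 1)) (P i) x) (hw x hx).le
      have h4 : 0 ≤ G * ((1 + |M|) * κ ^ (-r)) * B * (n : ℝ) ^ (-r) * q ^ (i + 1) := by positivity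
      have h5 : q ^ i = 2 ^ r * q ^ (i + 1) := by
        have : (2 : ℝ) ^ r * q = 1 := by
          rw [hq, ← Real.rpow_add two_pos, add_neg_cancel, Real.rpow_zero]
        rw [pow_succ', ← mul_assoc, this, one_mul]
      rw [h5] at h1
      linarith
  refine ⟨D, fun j => ?_, hDbd, fun x hx => ?_⟩
  · cases j with
    | zero =>
      rw [hD0]
      refine (natDegree_sub_le _ _).trans (max_le ((hPdeg 0).trans ?_) ?_)
      · simp only [pow_zero, zero_add, pow_one]; omega
      · simpa using natDegree_vpPoly_le hα hβ hmn f
    | succ i =>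
      rw [hDs]
      refine (natDegree_sub_le _ _).trans (max_le ((hPdeg (i + 1)).trans ?_) ((hPdeg i).trans ?_))
      · exact Nat.mul_le_mul_right n (Nat.pow_le_pow_right two_pos (by omega))
      · exact Nat.mul_le_mul_right n (Nat.pow_le_pow_right two_pos (by omega))
  · set w := jacobiWeight γ δ x with hwx
    have hw0 : 0 < w := hw x hx
    have hgeo := summable_geometric_of_lt_one hq0.le hq1
    have hsummable : Summable fun j => (D j).eval x := by
      refine Summable.of_norm_bounded
        (g := fun j => G * (1 + 2 ^ r + (1 + |M|) * κ ^ (-r)) * B * (n : ℝ) ^ (-r) * q ^ j / w)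
        ((hgeo.mul_left _).div_const w) fun j => ?_
      rw [Real.norm_eq_abs, le_div_iff₀ hw0]
      exact hDbd j x hx
    have hpartial : ∀ J, ∑ j ∈ Finset.range (J + 1), (D j).eval x = (P J).eval x - V.eval x := by
      intro J
      induction J with
      | zero => simp [hD0]
      | succ J ih => rw [Finset.sum_range_succ, ih, hDs, eval_sub]; ring
    have hPlim : Tendsto (fun J => (P J).eval x) atTop (𝓝 (f x)) := by
      rw [tendsto_iff_norm_sub_tendsto_zero]
      refine squeeze_zero (g := fun J => G * B * ((n : ℝ) ^ (-r) * q ^ J) / w)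
        (fun _ => norm_nonneg _) (fun J => ?_) ?_
      · rw [Real.norm_eq_abs, abs_sub_comm, le_div_iff₀ hw0]
        exact hPbd J x hx
      · have h := (tendsto_pow_atTop_nhds_zero_of_lt_one hq0.le hq1)
        have h' := ((h.const_mul ((n : ℝ) ^ (-r))).const_mul (G * B)).div_const w
        simpa using h'
    have hlim : Tendsto (fun J => ∑ j ∈ Finset.range J, (D j).eval x) atTop
        (𝓝 (f x - V.eval x)) := by
      rw [← tendsto_add_atTop_iff_nat 1]
      simp only [hpartial]
      exact hPlim.sub_const _
    rw [← tendsto_nhds_unique hsummable.hasSum.tendsto_sum_nat hlim]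
    exact hsummable.hasSum

end FilteredHilbert

open FilteredHilbert

theorem corollary4p3 (a b α β c₁ c₂ r : ℝ)
    (ha : -1 < a) (hb : -1 < b) (hα : -1 < α) (hβ : -1 < β)
    (hc₁ : 1 < c₁) (hc₂ : c₁ ≤ c₂) (hr : 0 < r)
    (hV : FilteredHilbert.VPUniformlyBounded α β (max 0 a) (max 0 b) c₁ c₂) :
    ∃ C : ℝ, 0 < C ∧
      ∀ n m : ℕ, FilteredHilbert.Comparable c₁ c₂ n m →
      ∀ f : ℝ → ℝ, FilteredHilbert.MemBesov r (max 0 a) (max 0 b) f →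
      ∀ t ∈ Set.Ioo (-1 : ℝ) 1,
        FilteredHilbert.HilbertExists a b f t ∧
        FilteredHilbert.HilbertExists a b
          (fun x => (FilteredHilbert.vpPoly α β n m f).eval x) t ∧
        FilteredHilbert.quadError a b α β n m f t * FilteredHilbert.uTwo a b t ≤
          C * (|f t - (FilteredHilbert.vpPoly α β n m f).eval t| * FilteredHilbert.uPlus a b t) +
          C * (Real.log n / (n : ℝ) ^ r * FilteredHilbert.normBesov r (max 0 a) (max 0 b) f) := by
  obtain ⟨M, hM⟩ := hV
  have hγ : 0 ≤ max 0 a := le_max_left _ _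
  have hδ : 0 ≤ max 0 b := le_max_left _ _
  have hκ : 0 < 1 - 1 / c₁ := by
    have : 1 / c₁ < 1 := by rw [div_lt_one (by linarith)]; exact hc₁
    linarith
  obtain ⟨C₁, hC₁, hpoly⟩ := exists_truncHilbert_polynomial_bound ha hb
  obtain ⟨C₂, hC₂, hseries⟩ := exists_hilbert_series_bound (q := (2 : ℝ) ^ (-r)) ha hb
    (by positivity) (Real.rpow_lt_one_of_one_lt_of_neg (by norm_num) (by linarith))
  set G : ℝ := 2 * 2 ^ |r - 1| * (1 + 2 ^ r + (1 + |M|) * (1 - 1 / c₁) ^ (-r)) with hG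
  have hG0 : 0 < G := by positivity
  refine ⟨C₂ * G, by positivity, ?_⟩
  intro n m hnm f hf t ht
  obtain ⟨hm, hmn, hc, -⟩ := id hnm
  have hn2 : 2 ≤ n := by omega
  have hn0 : (0 : ℝ) < n := by exact_mod_cast (by omega : 0 < n)
  set V := vpPoly α β n m f with hVdef
  have hVpoly : MemC0 (max 0 a) (max 0 b) (fun x => V.eval x) := memC0_polynomial hγ hδ V
  have hVex : HilbertExists a b (fun x => V.eval x) t := by
    refine (hpoly (2 * n) V (normC0 (max 0 a) (max 0 b) (fun x => V.eval x) + 1) t (by omega)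
      (natDegree_vpPoly_le hα hβ hmn f) (add_pos_of_nonneg_of_pos (normC0_nonneg _ _ _) one_pos) (fun x hx => ?_) ht).1
    exact (hVpoly.le_normC0 hx).trans (by linarith)
  have hRcont : ContinuousOn (fun x => f x - V.eval x) (Set.Ioo (-1) 1) :=
    hf.1.1.sub V.continuous.continuousOn
  set Y := normBesov r (max 0 a) (max 0 b) f with hY
  have hY0 : 0 ≤ Y := normBesov_nonneg _ _ _ _
  have hmain : ∀ η : ℝ, 0 < η → HilbertExists a b (fun x => f x - V.eval x) t ∧
      |hilbert a b (fun x => f x - V.eval x) t| * uTwo a b t ≤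
        C₂ * G * (Real.log n / (n : ℝ) ^ r) * (Y + η) := by
    intro η hη
    obtain ⟨D, hdeg, hbd, hsum⟩ := exists_polynomial_series hα hβ hγ hδ hc₁ hr hη hm hmn hc
      (hM n m hnm) hf
    obtain ⟨hex, hle⟩ := hseries n (fun x => f x - V.eval x) D (G * (Y + η) * (n : ℝ) ^ (-r)) t
      hn2 (by positivity) hRcont hdeg hbd hsum ht
    refine ⟨hex, hle.trans (le_of_eq ?_)⟩
    rw [Real.rpow_neg hn0.le]
    ring
  have hRex := (hmain 1 one_pos).1
  obtain ⟨hfex, hadd⟩ := hRex.add hVex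
  simp only [sub_add_cancel] at hfex hadd
  refine ⟨hfex, hVex, ?_⟩
  have hlog : 0 < Real.log n := by linarith [half_le_log hn2]
  have hK : 0 < C₂ * G * (Real.log n / (n : ℝ) ^ r) := by positivity
  have hbound : |hilbert a b (fun x => f x - V.eval x) t| * uTwo a b t ≤
      C₂ * G * (Real.log n / (n : ℝ) ^ r) * Y := by
    refine le_of_forall_pos_le_add fun ε hε => ?_
    refine (hmain (ε / (C₂ * G * (Real.log n / (n : ℝ) ^ r))) (by positivity)).2.trans
      (le_of_eq ?_)
    rw [mul_add, mul_div_cancel₀ _ hK.ne']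
  -- The second summand of the bound already suffices.
  have hfirst : 0 ≤ C₂ * G * (|f t - V.eval t| * uPlus a b t) :=
    mul_nonneg (by positivity) (mul_nonneg (abs_nonneg _) (uPlus_pos a b ht).le)
  rw [quadError, vpRule, hadd, add_sub_cancel_right]
  linarith
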